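/- **Setting.** Let $d\in\{1,2\}$, let $\mathcal D\subset\mathbb R^d$ be a bounded domain with smooth boundary, and let $U=L^2(\mathcal D;\mathbb R)$ with norm $\|\cdot\|$ and inner product $\langle\cdot,\cdot\rangle$. Let $\Lambda=-\Delta$ with $\mathrm{Dom}(\Lambda)=H^2(\mathcal D)\cap H^1_0(\mathcal D)$, with eigenvalues $\lambda_1\le\lambda_2\le\cdots$ and an orthonormal basis $(\varphi_j)_{j\ge1}$ of $U$ of corresponding eigenfunctions. For $\alpha\in\mathbb R$ put $\|u\|_\alpha^2=\sum_j\lambda_j^{\alpha}\langle u,\varphi_j\rangle^2$ and $\|[x_1,x_2]^T\|_{\mathbb H^\alpha}^2=\|x_1\|_\alpha^2+\|x_2\|_{\alpha-1}^2$; in particular $\|[x_1,x_2]^T\|_{\mathbb H^1}^2=\|x_1\|_1^2+\|x_2\|^2$. Let $f\in C^2(\mathbb R;\mathbb R)$ satisfy, for all $v\in\mathbb R$, $vf(v)\le C_0(1+|v|^2)$, $f'(v)\le C_1$, $|f'(v)|\le C_2(1+|v|^{\gamma-1})$ and $|f''(v)|\le C_3(1+|v|^{\gamma-2})$, with constants $C_0,C_2,C_3>0$,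 $C_1\in\mathbb R$, $\gamma\ge2$, and let $F(v)(x)=f(v(x))$. Let $T>0$ and let $W$ be a $Q$-Wiener process in $U$ on $[0,T]$ with respect to a filtered probability space $(\Omega,\mathcal F,\mathbb P,\{\mathcal F_t\}_{t\ge0})$, where $Q$ is bounded, self-adjoint and positive semidefinite and $\Lambda^{1/2}Q^{1/2}$ is a Hilbert–Schmidt operator on $U$. Let $(u_0,v_0)$ be an $\mathcal F_0$-measurable $U\times U$-valued initial value. For $N\ge1$ let $U_N=\mathrm{span}\{\varphi_1,\dots,\varphi_N\}$, let $P_N$ be the orthogonal projection of $U$ onto $U_N$, let $\Lambda_N=\Lambda|_{U_N}$, and for $X=[u,v]^T$ let $\mathbf F_N(X)=[0,P_NF(v)]^T$, $B_N=[0,P_N]^T$ and $$E_N(t)=\begin{bmatrix}\cos(t\Lambda_N^{1/2})&\Lambda_N^{-1/2}\sin(t\Lambda_N^{1/2})\\-\Lambda_N^{1/2}\sin(t\Lambda_N^{1/2})&\cos(t\Lambda_N^{1/2})\end{bmatrix}.$$ Let $X^N$ be the mild solution of the spectral Galerkin system, that is, the adapted, almost surely continuous $U_N\times U_N$-valued process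 with $X^N(0)=[P_Nu_0,P_Nv_0]^T$ and, for each $t\in[0,T]$, almost surely $$X^N(t)=E_N(t)X^N(0)+\int_0^tE_N(t-s)\mathbf F_N(X^N(s))\,ds+\int_0^tE_N(t-s)B_N\,dW(s).$$ For $M\in\mathbb N$, $M\ge 1$, let $\tau=T/M$, $t_m=m\tau$, $\Delta W_m=W(t_{m+1})-W(t_m)$, and let $(X_{N,m})_{0\le m\le M}$ be a solution of the fully discrete scheme $X_{N,0}=X^N(0)$, $$X_{N,m+1}=E_N(\tau)X_{N,m}+\tau\,\mathbf F_N(X_{N,m+1})+E_N(\tau)B_N\Delta W_m\quad\text{a.s.}$$ Put $e_{N,m}=X^N(t_m)-X_{N,m}$ and $$R_{m+1}=\int_{t_m}^{t_{m+1}}\bigl(E_N(t_{m+1}-s)\mathbf F_N(X^N(s))-\mathbf F_N(X^N(t_{m+1}))\bigr)\,ds+\int_{t_m}^{t_{m+1}}E_N(t_{m+1}-s)B_N\,dW(s)-E_N(\tau)B_N\Delta W_m .$$ **Proposition (upper error bound).** There is a constant $C>0$, independent of $m$, $N$ and $M$, such that for all $N\ge1$, $M\ge1$ with $\tau\le\frac{1}{6\max\{0,C_1\}}$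 (no restriction if $C_1\le0$) and all $m\in\{0,\dots,M-1\}$, $$\mathbb E\bigl[\|e_{N,m+1}\|_{\mathbb H^1}^2\bigr]\le C\Bigl(\sum_{i=1}^{m+1}\mathbb E\bigl[\|R_i\|_{\mathbb H^1}^2\bigr]+\tau^{-1}\sum_{i=0}^{m}\mathbb E\bigl[\bigl\|\mathbb E[R_{i+1}\,|\,\mathcal F_{t_i}]\bigr\|_{\mathbb H^1}^2\bigr]\Bigr),$$ as an inequality in $[0,\infty]$ (if some $\mathbb E[\|R_i\|_{\mathbb H^1}^2]$ with $1\le i\le m+1$ is infinite, the right-hand side is $+\infty$). -/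

import Mathlib

open MeasureTheory ProbabilityTheory Filter Topology
open scoped NNReal ENNReal

noncomputable section

namespace DampedWave

/-! ### The spatial domain, Sobolev spaces and the Dirichlet Laplacian -/

/-- `D ⊆ ℝᵈ` is a bounded domain (open, connected, nonempty) with smooth boundary: near each
boundary point, `D` is the sublevel set `{ρ < 0}` of a smooth `ρ` with nonvanishing differential. -/
structure IsSmoothBoundedDomain {d : ℕ} (D : Set (EuclideanSpace ℝ (Fin d))) : Prop where
  isOpen : IsOpen D
  isConnected : IsConnected D
  isBounded : Bornology.IsBounded D
  smooth_boundary : ∀ x ∈ frontier D, ∃ V ∈ 𝓝 x, ∃ ρ : EuclideanSpace ℝ (Fin d) → ℝ,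
    ContDiff ℝ (⊤ : ℕ∞) ρ ∧ fderiv ℝ ρ x ≠ 0 ∧ D ∩ V = {y | y ∈ V ∧ ρ y < 0}

/-- The Hilbert space `U = L²(D; ℝ)`. -/
abbrev L2 {d : ℕ} (D : Set (EuclideanSpace ℝ (Fin d))) : Type :=
  Lp ℝ 2 (volume.restrict D)

/-- Test functions: elements of `C_c^∞(D)`. -/
def IsTestFunction {d : ℕ} (D : Set (EuclideanSpace ℝ (Fin d)))
    (η : EuclideanSpace ℝ (Fin d) → ℝ) : Prop :=
  ContDiff ℝ (⊤ : ℕ∞) η ∧ HasCompactSupport η ∧ tsupport η ⊆ D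

/-- The classical partial derivative `∂ᵢ η`. -/
def partialDeriv {d : ℕ} (i : Fin d) (η : EuclideanSpace ℝ (Fin d) → ℝ) :
    EuclideanSpace ℝ (Fin d) → ℝ :=
  fun x => fderiv ℝ η x (EuclideanSpace.single i (1 : ℝ))

/-- `g ∈ L²(D)` is the weak partial derivative `∂ᵢ u` of `u ∈ L²(D)`. -/
def HasWeakPartial {d : ℕ} (D : Set (EuclideanSpace ℝ (Fin d))) (i : Fin d) (u g : L2 D) : Prop :=
  ∀ η : EuclideanSpace ℝ (Fin d) → ℝ, IsTestFunction D η →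
    ∫ x in D, u x * partialDeriv i η x = - ∫ x in D, g x * η x

/-- `u ∈ H¹₀(D)`, the closure of `C_c^∞(D)` for the `H¹` norm. -/
def MemH10 {d : ℕ} (D : Set (EuclideanSpace ℝ (Fin d))) (u : L2 D) : Prop :=
  ∃ (g : Fin d → L2 D) (η : ℕ → EuclideanSpace ℝ (Fin d) → ℝ),
    (∀ n, IsTestFunction D (η n)) ∧
    Tendsto (fun n => eLpNorm (fun x => η n x - u x) 2 (volume.restrict D)) atTop (𝓝 0) ∧
    ∀ i, Tendsto (fun n => eLpNorm (fun x => partialDeriv i (η n) x - g i x) 2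
      (volume.restrict D)) atTop (𝓝 0)

/-- `u ∈ Dom(Λ) = H²(D) ∩ H¹₀(D)` and `Λ u = -Δ u = w`. -/
def HasDirichletLaplacian {d : ℕ} (D : Set (EuclideanSpace ℝ (Fin d))) (u w : L2 D) : Prop :=
  MemH10 D u ∧
  ∃ (g : Fin d → L2 D) (h : Fin d → Fin d → L2 D),
    (∀ i, HasWeakPartial D i u (g i)) ∧
    (∀ i j, HasWeakPartial D j (g i) (h i j)) ∧
    w = - ∑ i, h i i

/-- `(lam j, φ j)` are the eigenpairs of `Λ`, in nondecreasing order of the eigenvalues, the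
eigenfunctions forming an orthonormal basis of `L²(D)`. The numbering starts at `0`. -/
structure IsDirichletEigensystem {d : ℕ} (D : Set (EuclideanSpace ℝ (Fin d)))
    (lam : ℕ → ℝ) (φ : HilbertBasis ℕ ℝ (L2 D)) : Prop where
  monotone : Monotone lam
  eigen : ∀ j, HasDirichletLaplacian D (φ j) (lam j • φ j)

section Spectral

variable {d : ℕ} {D : Set (EuclideanSpace ℝ (Fin d))}

/-- `‖u‖_α² = ∑ⱼ λⱼ^α ⟨u, φⱼ⟩²`, the squared norm of `Ḣ^α` (infinite outside `Ḣ^α`). -/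
def hdotNormSq (lam : ℕ → ℝ) (φ : HilbertBasis ℕ ℝ (L2 D)) (α : ℝ) (u : L2 D) : ℝ≥0∞ :=
  ∑' j, ENNReal.ofReal (lam j ^ α * (inner ℝ (φ j) u) ^ 2)

/-- `‖X‖²_{ℍ^α} = ‖x₁‖_α² + ‖x₂‖_{α-1}²`. -/
def prodNormSq (lam : ℕ → ℝ) (φ : HilbertBasis ℕ ℝ (L2 D)) (α : ℝ) (X : L2 D × L2 D) : ℝ≥0∞ :=
  hdotNormSq lam φ α X.1 + hdotNormSq lam φ (α - 1) X.2

/-- `U_N`, the span of the first `N` eigenfunctions. -/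
def galerkinSpace (φ : HilbertBasis ℕ ℝ (L2 D)) (N : ℕ) : Submodule ℝ (L2 D) :=
  Submodule.span ℝ {u | ∃ i < N, u = φ i}

/-- The operator `ψ ↦ ∑_{i < N} c i ⟨ψ, φᵢ⟩ φᵢ`. -/
def diagOp (φ : HilbertBasis ℕ ℝ (L2 D)) (N : ℕ) (c : ℕ → ℝ) : L2 D →L[ℝ] L2 D :=
  ∑ i ∈ Finset.range N, c i • (innerSL ℝ (φ i)).smulRight (φ i)

/-- The projection `P_N` onto `U_N`. -/
def projN (φ : HilbertBasis ℕ ℝ (L2 D)) (N : ℕ) : L2 D →L[ℝ] L2 D :=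
  diagOp φ N (fun _ => 1)

/-- The discrete group `E_N(t)` with blocks `C_N(t)`, `Λ_N^{-1/2} S_N(t)`, `-Λ_N^{1/2} S_N(t)`,
`C_N(t)`, where `C_N(t) = cos(t Λ_N^{1/2})` and `S_N(t) = sin(t Λ_N^{1/2})`. -/
def groupN (lam : ℕ → ℝ) (φ : HilbertBasis ℕ ℝ (L2 D)) (N : ℕ) (t : ℝ) :
    L2 D × L2 D →L[ℝ] L2 D × L2 D :=
  ((diagOp φ N fun i => Real.cos (t * √(lam i))).comp (ContinuousLinearMap.fst ℝ _ _) +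
    (diagOp φ N fun i => (√(lam i))⁻¹ * Real.sin (t * √(lam i))).comp
      (ContinuousLinearMap.snd ℝ _ _)).prod
  ((diagOp φ N fun i => -(√(lam i) * Real.sin (t * √(lam i)))).comp
      (ContinuousLinearMap.fst ℝ _ _) +
    (diagOp φ N fun i => Real.cos (t * √(lam i))).comp (ContinuousLinearMap.snd ℝ _ _))

/-- The noise operator `B_N = [0, P_N]ᵀ`. -/
def noiseN (φ : HilbertBasis ℕ ℝ (L2 D)) (N : ℕ) : L2 D →L[ℝ] L2 D × L2 D :=
  (0 : L2 D →L[ℝ] L2 D).prod (projN φ N)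

open Classical in
/-- The Nemytskij operator `F(v)(x) = f(v(x))` on those `v ∈ L²(D)` with `f ∘ v ∈ L²(D)`
(and `0` otherwise). -/
def nemytskij (f : ℝ → ℝ) (v : L2 D) : L2 D :=
  if h : MemLp (fun x => f (v x)) 2 (volume.restrict D) then h.toLp (fun x => f (v x)) else 0

/-- `𝐅_N(X) = [0, P_N F(v)]ᵀ` for `X = [u, v]ᵀ`. -/
def driftN (φ : HilbertBasis ℕ ℝ (L2 D)) (f : ℝ → ℝ) (N : ℕ) (X : L2 D × L2 D) : L2 D × L2 D :=
  (0, projN φ N (nemytskij f X.2))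

end Spectral

/-! ### Assumptions on the nonlinearity and on the noise -/

/-- The assumptions on the real function `f` defining the nonlinear damping. -/
structure IsDamping (f : ℝ → ℝ) (C₀ C₁ C₂ C₃ γ : ℝ) : Prop where
  contDiff : ContDiff ℝ 2 f
  C₀_pos : 0 < C₀
  C₂_pos : 0 < C₂
  C₃_pos : 0 < C₃
  two_le : 2 ≤ γ
  mul_le : ∀ v, v * f v ≤ C₀ * (1 + |v| ^ 2)
  deriv_le : ∀ v, deriv f v ≤ C₁
  abs_deriv_le : ∀ v, |deriv f v| ≤ C₂ * (1 + |v| ^ (γ - 1))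
  abs_deriv_two_le : ∀ v, |deriv (deriv f) v| ≤ C₃ * (1 + |v| ^ (γ - 2))

/-- `Q` is positive semidefinite and self-adjoint, `S = Q^{1/2}` is its positive square root, and
`‖Λ^{1/2} Q^{1/2}‖_{𝓛₂(U)}² = ∑ₖ ‖Λ^{1/2} Q^{1/2} φₖ‖²` is finite. -/
structure IsNoiseCovariance {d : ℕ} {D : Set (EuclideanSpace ℝ (Fin d))}
    (lam : ℕ → ℝ) (φ : HilbertBasis ℕ ℝ (L2 D)) (Q S : L2 D →L[ℝ] L2 D) : Prop where
  isPositive : Q.IsPositive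
  sqrt_isPositive : S.IsPositive
  sqrt_comp_sqrt : S.comp S = Q
  hilbertSchmidt : ∑' k, hdotNormSq lam φ 1 (S (φ k)) < ∞

section Probability

variable {U H Ω : Type*} [NormedAddCommGroup U] [InnerProductSpace ℝ U]
  [NormedAddCommGroup H] [NormedSpace ℝ H] {mΩ : MeasurableSpace Ω}

/-- `W` is a `Q`-Wiener process on `[0, T]` with respect to the filtration `ℱ`. The last field
says that `W t - W s` has the law `N(0, (t - s) Q)`. -/
structure IsQWiener (μ : Measure Ω) (ℱ : Filtration ℝ≥0 mΩ) (Q : U →L[ℝ] U) (T : ℝ≥0)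
    (W : ℝ≥0 → Ω → U) : Prop where
  zero : ∀ᵐ ω ∂μ, W 0 ω = 0
  adapted : ∀ t ≤ T, StronglyMeasurable[ℱ t] (W t)
  continuous_paths : ∀ᵐ ω ∂μ, ContinuousOn (fun t => W t ω) (Set.Iic T)
  indep : ∀ s t, s ≤ t → t ≤ T →
    Indep (MeasurableSpace.comap (fun ω => W t ω - W s ω) (borel U)) (ℱ s) μ
  gaussian : ∀ s t, s ≤ t → t ≤ T → ∀ u : U,
    μ.map (fun ω => inner ℝ u (W t ω - W s ω)) =
      gaussianReal 0 (Real.toNNReal (((t : ℝ) - s) * inner ℝ (Q u) u))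

/-- `I` is (a version of) the stochastic integral `∫ₐᵇ Φ(s) dW(s)` of a deterministic continuous
operator-valued integrand `Φ`: the limit in `L²(Ω; H)` of the sums
`∑ₖ Φ(pₖ) (W(pₖ₊₁) - W(pₖ))` as the mesh of the partition `a = p₀ ≤ ⋯ ≤ pₙ = b` tends to `0`. -/
def HasStochIntegral (μ : Measure Ω) (W : ℝ≥0 → Ω → U) (Φ : ℝ≥0 → U →L[ℝ] H) (a b : ℝ≥0)
    (I : Ω → H) : Prop :=
  MemLp I 2 μ ∧
  ∀ ε : ℝ, 0 < ε → ∃ δ : ℝ≥0, 0 < δ ∧ ∀ (n : ℕ) (p : ℕ → ℝ≥0),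
    Monotone p → p 0 = a → p n = b → (∀ k < n, p (k + 1) ≤ p k + δ) →
    eLpNorm (fun ω => (∑ k ∈ Finset.range n, Φ (p k) (W (p (k + 1)) ω - W (p k) ω)) - I ω) 2 μ
      ≤ ENNReal.ofReal ε

open Classical in
/-- The stochastic integral `∫ₐᵇ Φ(s) dW(s)`, determined up to almost sure equality. -/
def stochIntegral (μ : Measure Ω) (W : ℝ≥0 → Ω → U) (Φ : ℝ≥0 → U →L[ℝ] H) (a b : ℝ≥0) : Ω → H :=
  if h : ∃ I, HasStochIntegral μ W Φ a b I then h.choose else 0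

end Probability

/-! ### The semi-discrete solution, the fully discrete scheme and the remainder -/

/-- The grid point `t_m = m τ`, `τ = T / M`. -/
def gridPt (T : ℝ≥0) (M m : ℕ) : ℝ≥0 := m * (T / M)

section Discretization

variable {d : ℕ} {D : Set (EuclideanSpace ℝ (Fin d))} {Ω : Type*} {mΩ : MeasurableSpace Ω}

/-- `X = X^N` is the mild solution on `[0, T]` of the spectral Galerkin system
`dX = A_N X dt + 𝐅_N(X) dt + B_N dW`, `X(0) = [P_N u₀, P_N v₀]ᵀ`: an adapted process with values
in `U_N × U_N` and almost surely continuous paths such that, for each `t ∈ [0, T]`, almost surely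
`X(t) = E_N(t) X(0) + ∫₀ᵗ E_N(t-s) 𝐅_N(X(s)) ds + ∫₀ᵗ E_N(t-s) B_N dW(s)`. -/
structure IsGalerkinSolution (lam : ℕ → ℝ) (φ : HilbertBasis ℕ ℝ (L2 D)) (f : ℝ → ℝ)
    (μ : Measure Ω) (ℱ : Filtration ℝ≥0 mΩ) (T : ℝ≥0) (W : ℝ≥0 → Ω → L2 D)
    (u₀ v₀ : Ω → L2 D) (N : ℕ) (X : ℝ≥0 → Ω → L2 D × L2 D) : Prop where
  mem : ∀ t ≤ T, ∀ ω, (X t ω).1 ∈ galerkinSpace φ N ∧ (X t ω).2 ∈ galerkinSpace φ N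
  adapted : ∀ t ≤ T, StronglyMeasurable[ℱ t] (X t)
  continuous_paths : ∀ᵐ ω ∂μ, ContinuousOn (fun t => X t ω) (Set.Iic T)
  initial : ∀ᵐ ω ∂μ, X 0 ω = (projN φ N (u₀ ω), projN φ N (v₀ ω))
  mild : ∀ t ≤ T, ∃ I : Ω → L2 D × L2 D,
    HasStochIntegral μ W
      (fun s => (groupN lam φ N ((t : ℝ) - s)).comp (noiseN φ N)) 0 t I ∧
    ∀ᵐ ω ∂μ, X t ω = groupN lam φ N t (X 0 ω)
      + (∫ s in (0 : ℝ)..t, groupN lam φ N (t - s) (driftN φ f N (X s.toNNReal ω))) + I ω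

/-- `Y m = X_{N,m}`, `m = 0, …, M`, solves the modified implicit exponential Euler scheme
`X_{N,m+1} = E_N(τ) X_{N,m} + τ 𝐅_N(X_{N,m+1}) + E_N(τ) B_N (W(t_{m+1}) - W(t_m))`. -/
structure IsEulerScheme (lam : ℕ → ℝ) (φ : HilbertBasis ℕ ℝ (L2 D)) (f : ℝ → ℝ)
    (μ : Measure Ω) (T : ℝ≥0) (W : ℝ≥0 → Ω → L2 D) (u₀ v₀ : Ω → L2 D) (N M : ℕ)
    (Y : ℕ → Ω → L2 D × L2 D) : Prop where
  initial : ∀ᵐ ω ∂μ, Y 0 ω = (projN φ N (u₀ ω), projN φ N (v₀ ω))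
  step : ∀ m < M, ∀ᵐ ω ∂μ, Y (m + 1) ω =
    groupN lam φ N ((T : ℝ) / M) (Y m ω) + ((T : ℝ) / M) • driftN φ f N (Y (m + 1) ω)
      + groupN lam φ N ((T : ℝ) / M)
          (noiseN φ N (W (gridPt T M (m + 1)) ω - W (gridPt T M m) ω))

/-- The remainder
`R_{m+1} = ∫_{t_m}^{t_{m+1}} (E_N(t_{m+1}-s) 𝐅_N(X^N(s)) - 𝐅_N(X^N(t_{m+1}))) ds
  + ∫_{t_m}^{t_{m+1}} E_N(t_{m+1}-s) B_N dW(s) - E_N(τ) B_N (W(t_{m+1}) - W(t_m))`.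
The value at the argument `m` is `R_{m+1}`. -/
def remainder (lam : ℕ → ℝ) (φ : HilbertBasis ℕ ℝ (L2 D)) (f : ℝ → ℝ) (μ : Measure Ω)
    (T : ℝ≥0) (W : ℝ≥0 → Ω → L2 D) (N M : ℕ) (X : ℝ≥0 → Ω → L2 D × L2 D) (m : ℕ) (ω : Ω) :
    L2 D × L2 D :=
  (∫ s in (gridPt T M m : ℝ)..(gridPt T M (m + 1)),
    (groupN lam φ N (gridPt T M (m + 1) - s) (driftN φ f N (X s.toNNReal ω))
      - driftN φ f N (X (gridPt T M (m + 1)) ω)))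
  + stochIntegral μ W
      (fun s => (groupN lam φ N ((gridPt T M (m + 1) : ℝ) - s)).comp (noiseN φ N))
      (gridPt T M m) (gridPt T M (m + 1)) ω
  - groupN lam φ N ((T : ℝ) / M)
      (noiseN φ N (W (gridPt T M (m + 1)) ω - W (gridPt T M m) ω))

end Discretization

end DampedWave

end

/-! The argument is a mean-square stability estimate for one implicit step, followed by a discrete
Gronwall argument. By the group property and additivity of the stochastic integral, the exact
solution satisfies the scheme's recursion up to the defect $R_{m+1}$ (`IsGalerkinSolution.step`), so
the error obeys $e_{m+1}=E_N(\tau)e_m+\tau(\mathbf F_N(X^N(t_{m+1}))-\mathbf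
F_N(X_{N,m+1}))+R_{m+1}$.

Two structural facts make this stable in the energy norm. The group $E_N$ is an isometry of that
norm (`norm_energyMap_groupN`). The drift acts only on the velocity, where the energy norm is the
$L^2$ norm, and there $f'\le C_1$ makes it one-sided Lipschitz (`inner_nemytskij_sub_le`). Expanding
the square (`norm_sq_implicit_step_le`) leaves the cross term $2\langle
R_{m+1},E_N(\tau)e_m\rangle$. Since $e_m$ is $\mathcal F_{t_m}$-measurable, $R_{m+1}$ may be
replaced there by its conditional expectation; Young's inequality with weight $\tau$ then yields the
factor $\tau^{-1}$ (`integral_norm_sq_step_le`). As $e_0=0$, iterating gives the bound with a factor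
$\exp((3\max\{0,C_1\}+1)T)$ (`integral_norm_sq_le_sum`).

The rest justifies these manipulations. The Sobolev embedding in dimension at most two puts $f\circ
v$ in $L^2$ for $v\in U_N$. The scheme is only assumed to satisfy its implicit equation almost
surely, so its adaptedness is derived from strong monotonicity
(`IsEulerScheme.aestronglyMeasurable`). No moments of the solution, the scheme or the initial value
are needed: the square integrability of the error propagates from that of the remainders. -/

namespace DampedWave

/-! ### Spectral calculus on the Galerkin space and the energy norm. -/

section Spectral

variable {d : ℕ} {D : Set (EuclideanSpace ℝ (Fin d))}

theorem diagOp_apply (φ : HilbertBasis ℕ ℝ (L2 D)) (N : ℕ) (c : ℕ → ℝ) (u : L2 D) :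
    diagOp φ N c u = ∑ i ∈ Finset.range N, (c i * inner ℝ (φ i) u) • φ i := by
  simp [diagOp, mul_smul]

theorem inner_sum_basis (φ : HilbertBasis ℕ ℝ (L2 D)) (N : ℕ) (c : ℕ → ℝ) (j : ℕ) :
    inner ℝ (φ j) (∑ i ∈ Finset.range N, c i • φ i) = if j < N then c j else 0 := by
  have h := orthonormal_iff_ite.1 φ.orthonormal
  simp [inner_sum, inner_smul_right, h]

theorem inner_diagOp (φ : HilbertBasis ℕ ℝ (L2 D)) (N : ℕ) (c : ℕ → ℝ) (u : L2 D) (j : ℕ) :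
    inner ℝ (φ j) (diagOp φ N c u) = if j < N then c j * inner ℝ (φ j) u else 0 := by
  rw [diagOp_apply, inner_sum_basis]

theorem hilbertBasis_ext (φ : HilbertBasis ℕ ℝ (L2 D)) {u v : L2 D}
    (h : ∀ j, inner ℝ (φ j) u = inner ℝ (φ j) v) : u = v := by
  apply φ.repr.injective
  ext j
  simpa [HilbertBasis.repr_apply_apply] using h j

theorem mem_galerkinSpace_sum (φ : HilbertBasis ℕ ℝ (L2 D)) (N : ℕ) (c : ℕ → ℝ) :
    ∑ i ∈ Finset.range N, c i • φ i ∈ galerkinSpace φ N :=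
  Submodule.sum_mem _ fun i hi => Submodule.smul_mem _ _
    (Submodule.subset_span ⟨i, Finset.mem_range.1 hi, rfl⟩)

theorem diagOp_mem (φ : HilbertBasis ℕ ℝ (L2 D)) (N : ℕ) (c : ℕ → ℝ) (u : L2 D) :
    diagOp φ N c u ∈ galerkinSpace φ N := by
  rw [diagOp_apply]
  exact mem_galerkinSpace_sum φ N _

theorem projN_of_mem (φ : HilbertBasis ℕ ℝ (L2 D)) {N : ℕ} {u : L2 D}
    (hu : u ∈ galerkinSpace φ N) : projN φ N u = u := by
  induction hu using Submodule.span_induction with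
  | mem x hx =>
    obtain ⟨i, hi, rfl⟩ := hx
    refine hilbertBasis_ext φ fun j => ?_
    have h := orthonormal_iff_ite.1 φ.orthonormal
    rw [projN, inner_diagOp, h]
    split_ifs <;> simp_all
  | zero => simp
  | add x y _ _ hx hy => rw [map_add, hx, hy]
  | smul a x _ hx => rw [map_smul, hx]

theorem eq_sum_of_mem (φ : HilbertBasis ℕ ℝ (L2 D)) {N : ℕ} {u : L2 D}
    (hu : u ∈ galerkinSpace φ N) :
    u = ∑ i ∈ Finset.range N, (inner ℝ (φ i) u : ℝ) • φ i := by
  conv_lhs => rw [← projN_of_mem φ hu, projN, diagOp_apply]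
  simp

theorem norm_sq_sum_basis (φ : HilbertBasis ℕ ℝ (L2 D)) (N : ℕ) (c : ℕ → ℝ) :
    ‖∑ i ∈ Finset.range N, c i • φ i‖ ^ 2 = ∑ i ∈ Finset.range N, c i ^ 2 := by
  rw [← real_inner_self_eq_norm_sq, φ.orthonormal.inner_sum]
  simp [sq]

theorem inner_projN_left (φ : HilbertBasis ℕ ℝ (L2 D)) {N : ℕ} (u : L2 D) {v : L2 D}
    (hv : v ∈ galerkinSpace φ N) : inner ℝ (projN φ N u) v = inner ℝ u v := by
  conv_rhs => rw [← projN_of_mem φ hv]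
  simp only [projN, diagOp_apply, one_mul, inner_sum, inner_smul_right, sum_inner,
    inner_smul_left, RCLike.conj_to_real]
  simp [real_inner_comm, mul_comm]

/-- The product `U_N × U_N`. -/
noncomputable def galerkinProd (φ : HilbertBasis ℕ ℝ (L2 D)) (N : ℕ) : Submodule ℝ (L2 D × L2 D) :=
  (galerkinSpace φ N).prod (galerkinSpace φ N)

theorem groupN_fst (lam : ℕ → ℝ) (φ : HilbertBasis ℕ ℝ (L2 D)) (N : ℕ) (t : ℝ)
    (x : L2 D × L2 D) :
    (groupN lam φ N t x).1 = diagOp φ N (fun i => Real.cos (t * √(lam i))) x.1 +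
      diagOp φ N (fun i => (√(lam i))⁻¹ * Real.sin (t * √(lam i))) x.2 := rfl

theorem groupN_snd (lam : ℕ → ℝ) (φ : HilbertBasis ℕ ℝ (L2 D)) (N : ℕ) (t : ℝ)
    (x : L2 D × L2 D) :
    (groupN lam φ N t x).2 = diagOp φ N (fun i => -(√(lam i) * Real.sin (t * √(lam i)))) x.1 +
      diagOp φ N (fun i => Real.cos (t * √(lam i))) x.2 := rfl

theorem groupN_mem (lam : ℕ → ℝ) (φ : HilbertBasis ℕ ℝ (L2 D)) (N : ℕ) (t : ℝ)
    (x : L2 D × L2 D) : groupN lam φ N t x ∈ galerkinProd φ N :=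
  ⟨Submodule.add_mem _ (diagOp_mem _ _ _ _) (diagOp_mem _ _ _ _),
    Submodule.add_mem _ (diagOp_mem _ _ _ _) (diagOp_mem _ _ _ _)⟩

theorem groupN_add (lam : ℕ → ℝ) (φ : HilbertBasis ℕ ℝ (L2 D)) (N : ℕ) (t r : ℝ)
    (x : L2 D × L2 D) :
    groupN lam φ N (t + r) x = groupN lam φ N t (groupN lam φ N r x) := by
  refine Prod.ext (hilbertBasis_ext φ fun j => ?_) (hilbertBasis_ext φ fun j => ?_)
  all_goals
    simp only [groupN_fst, groupN_snd, inner_add_right, inner_diagOp]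
    split_ifs with hj
    · rw [add_mul, Real.cos_add, Real.sin_add]
      rcases eq_or_ne (√(lam j)) 0 with h | h
      · simp [h]
      · field_simp
        ring
    · simp

/-- The isometry of `(U_N × U_N, ℍ¹)` onto a closed subspace of a Hilbert space,
`[u, v]ᵀ ↦ [Λ_N^{1/2} P_N u, P_N v]ᵀ`. -/
noncomputable def energyMap (lam : ℕ → ℝ) (φ : HilbertBasis ℕ ℝ (L2 D)) (N : ℕ) :
    L2 D × L2 D →L[ℝ] WithLp 2 (L2 D × L2 D) :=
  (WithLp.prodContinuousLinearEquiv 2 ℝ (L2 D) (L2 D)).symm.toContinuousLinearMap.comp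
    (((diagOp φ N fun i => √(lam i)).comp (ContinuousLinearMap.fst ℝ _ _)).prod
      ((projN φ N).comp (ContinuousLinearMap.snd ℝ _ _)))

theorem energyMap_apply (lam : ℕ → ℝ) (φ : HilbertBasis ℕ ℝ (L2 D)) (N : ℕ) (x : L2 D × L2 D) :
    energyMap lam φ N x = WithLp.toLp 2 (diagOp φ N (fun i => √(lam i)) x.1, projN φ N x.2) := rfl

theorem norm_sq_energyMap (lam : ℕ → ℝ) (φ : HilbertBasis ℕ ℝ (L2 D)) (N : ℕ)
    (x : L2 D × L2 D) :
    ‖energyMap lam φ N x‖ ^ 2 = ∑ i ∈ Finset.range N,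
      ((√(lam i) * inner ℝ (φ i) x.1) ^ 2 + (inner ℝ (φ i) x.2) ^ 2) := by
  rw [energyMap_apply, WithLp.prod_norm_sq_eq_of_L2]
  simp only [projN, diagOp_apply, one_mul, Finset.sum_add_distrib]
  exact congrArg₂ _ (norm_sq_sum_basis φ N _) (norm_sq_sum_basis φ N _)

theorem inner_energyMap_snd (lam : ℕ → ℝ) (φ : HilbertBasis ℕ ℝ (L2 D)) (N : ℕ)
    (v : L2 D) (x : L2 D × L2 D) :
    inner ℝ (energyMap lam φ N (0, v)) (energyMap lam φ N x) =
      inner ℝ (projN φ N v) (projN φ N x.2) := by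
  simp [energyMap_apply, WithLp.prod_inner_apply]

/-- In each mode, $E_N(t)$ is a rotation by the angle $t\sqrt{\lambda_i}$ in the coordinates
$(\sqrt{\lambda_i}\,u_i,v_i)$. Positivity of the eigenvalues is not used: if the real square root is
$0$, the energy sees only $v_i$, which is then left unchanged. -/
theorem norm_energyMap_groupN (lam : ℕ → ℝ) (φ : HilbertBasis ℕ ℝ (L2 D)) (N : ℕ) (t : ℝ)
    (x : L2 D × L2 D) :
    ‖energyMap lam φ N (groupN lam φ N t x)‖ = ‖energyMap lam φ N x‖ := by
  refine (sq_eq_sq₀ (norm_nonneg _) (norm_nonneg _)).1 ?_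
  rw [norm_sq_energyMap, norm_sq_energyMap]
  refine Finset.sum_congr rfl fun i hi => ?_
  simp only [groupN_fst, groupN_snd, inner_add_right, inner_diagOp, if_pos (Finset.mem_range.1 hi)]
  have h1 := Real.sin_sq_add_cos_sq (t * √(lam i))
  rcases eq_or_ne (√(lam i)) 0 with h | h
  · simp [h]
  · have h2 : Real.sin (t * √(lam i)) ^ 2 = 1 - Real.cos (t * √(lam i)) ^ 2 := by linarith
    field_simp
    ring_nf at h2 ⊢
    rw [h2]
    ring

theorem ofReal_mul_sq (a b : ℝ) : ENNReal.ofReal (a * b ^ 2) = ENNReal.ofReal ((√a * b) ^ 2) := by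
  rcases le_total 0 a with h | h
  · rw [mul_pow, Real.sq_sqrt h]
  · rw [Real.sqrt_eq_zero_of_nonpos h, ENNReal.ofReal_of_nonpos]
    · simp
    · exact mul_nonpos_of_nonpos_of_nonneg h (sq_nonneg b)

theorem prodNormSq_one (lam : ℕ → ℝ) (φ : HilbertBasis ℕ ℝ (L2 D)) (x : L2 D × L2 D) :
    prodNormSq lam φ 1 x = ∑' i, ENNReal.ofReal
      ((√(lam i) * inner ℝ (φ i) x.1) ^ 2 + (inner ℝ (φ i) x.2) ^ 2) := by
  simp only [prodNormSq, hdotNormSq, sub_self, Real.rpow_one, Real.rpow_zero, one_mul,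
    ofReal_mul_sq]
  rw [← ENNReal.tsum_add]
  refine tsum_congr fun i => ?_
  rw [← ENNReal.ofReal_add (by positivity) (by positivity)]

theorem ofReal_norm_sq_energyMap (lam : ℕ → ℝ) (φ : HilbertBasis ℕ ℝ (L2 D)) (N : ℕ)
    (x : L2 D × L2 D) :
    ‖energyMap lam φ N x‖ₑ ^ 2 = ∑ i ∈ Finset.range N, ENNReal.ofReal
      ((√(lam i) * inner ℝ (φ i) x.1) ^ 2 + (inner ℝ (φ i) x.2) ^ 2) := by
  rw [← ENNReal.ofReal_sum_of_nonneg (fun i _ => by positivity), ← norm_sq_energyMap,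
    ← ofReal_norm, ENNReal.ofReal_pow (norm_nonneg _)]

/-- The inequality for arbitrary arguments suffices on the side of the remainders; equality on
$U_N\times U_N$ is required only for the error itself. -/
theorem enorm_energyMap_sq_le (lam : ℕ → ℝ) (φ : HilbertBasis ℕ ℝ (L2 D)) (N : ℕ)
    (x : L2 D × L2 D) : ‖energyMap lam φ N x‖ₑ ^ 2 ≤ prodNormSq lam φ 1 x := by
  rw [prodNormSq_one, ofReal_norm_sq_energyMap]
  exact ENNReal.sum_le_tsum _

theorem enorm_energyMap_sq_eq (lam : ℕ → ℝ) (φ : HilbertBasis ℕ ℝ (L2 D)) {N : ℕ}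
    {x : L2 D × L2 D} (hx : x ∈ galerkinProd φ N) :
    ‖energyMap lam φ N x‖ₑ ^ 2 = prodNormSq lam φ 1 x := by
  rw [prodNormSq_one, ofReal_norm_sq_energyMap, tsum_eq_sum]
  intro i hi
  rw [← projN_of_mem φ hx.1, ← projN_of_mem φ hx.2, projN, inner_diagOp,
    inner_diagOp, if_neg (by simpa using hi), if_neg (by simpa using hi)]
  simp

/-- The left inverse `[u, v]ᵀ ↦ [Λ_N^{-1/2} u, v]ᵀ` of `energyMap` on `U_N × U_N`. -/
noncomputable def energyInv (lam : ℕ → ℝ) (φ : HilbertBasis ℕ ℝ (L2 D)) (N : ℕ) :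
    WithLp 2 (L2 D × L2 D) →L[ℝ] L2 D × L2 D :=
  (((diagOp φ N fun i => (√(lam i))⁻¹).comp (ContinuousLinearMap.fst ℝ _ _)).prod
      (ContinuousLinearMap.snd ℝ _ _)).comp
    (WithLp.prodContinuousLinearEquiv 2 ℝ (L2 D) (L2 D)).toContinuousLinearMap

theorem energyInv_energyMap (lam : ℕ → ℝ) (φ : HilbertBasis ℕ ℝ (L2 D)) (N : ℕ)
    (x : L2 D × L2 D) : energyInv lam φ N (energyMap lam φ N x) =
      (diagOp φ N (fun i => (√(lam i))⁻¹) (diagOp φ N (fun i => √(lam i)) x.1),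
        projN φ N x.2) := rfl

theorem energyInv_energyMap_snd (lam : ℕ → ℝ) (φ : HilbertBasis ℕ ℝ (L2 D)) {N : ℕ}
    {v : L2 D} (hv : v ∈ galerkinSpace φ N) :
    energyInv lam φ N (energyMap lam φ N (0, v)) = (0, v) := by
  simp [energyInv_energyMap, projN_of_mem φ hv]

/-- In a mode with $\sqrt{\lambda_j}=0$ nothing is lost: the coefficient
$(\sqrt{\lambda_j})^{-1}\sin(t\sqrt{\lambda_j})$ of the first component vanishes as well. Hence data
of the form $E_N(t)[0,v]^T$ can be recovered from the energy coordinates whatever the sign of the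
eigenvalues. -/
theorem energyInv_energyMap_groupN (lam : ℕ → ℝ) (φ : HilbertBasis ℕ ℝ (L2 D)) (N : ℕ) (t : ℝ)
    (v : L2 D) :
    energyInv lam φ N (energyMap lam φ N (groupN lam φ N t (0, v))) =
      groupN lam φ N t (0, v) := by
  rw [energyInv_energyMap, groupN_fst, groupN_snd]
  refine Prod.ext (hilbertBasis_ext φ fun j => ?_) ?_
  · simp only [groupN_fst, inner_diagOp, map_zero, zero_add]
    split_ifs with hj
    · rcases eq_or_ne (√(lam j)) 0 with h | h
      · simp [h]
      · field_simp
    · rfl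
  · exact projN_of_mem φ (groupN_mem lam φ N t (0, v)).2

end Spectral

/-! ### Sobolev embedding of $H^1_0$ into $L^q$ in dimensions one and two. -/

section Sobolev

variable {d : ℕ} {D : Set (EuclideanSpace ℝ (Fin d))}

theorem IsTestFunction.support_subset {η : EuclideanSpace ℝ (Fin d) → ℝ}
    (hη : IsTestFunction D η) : Function.support η ⊆ D :=
  (subset_tsupport η).trans hη.2.2

theorem IsTestFunction.support_fderiv_subset {η : EuclideanSpace ℝ (Fin d) → ℝ}
    (hη : IsTestFunction D η) : Function.support (fderiv ℝ η) ⊆ D :=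
  (_root_.support_fderiv_subset ℝ).trans hη.2.2

theorem IsTestFunction.eLpNorm_fderiv_restrict {η : EuclideanSpace ℝ (Fin d) → ℝ}
    (hη : IsTestFunction D η) (p : ℝ≥0∞) :
    eLpNorm (fderiv ℝ η) p (volume.restrict D) = eLpNorm (fderiv ℝ η) p volume := by
  rw [← eLpNorm_norm, ← eLpNorm_norm (fderiv ℝ η)]
  refine eLpNorm_restrict_eq_of_support_subset fun x hx => hη.support_fderiv_subset fun h => hx ?_
  simp [h]

theorem IsTestFunction.continuous_fderiv {η : EuclideanSpace ℝ (Fin d) → ℝ}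
    (hη : IsTestFunction D η) : Continuous (fderiv ℝ η) :=
  hη.1.continuous_fderiv (by simp)

theorem IsTestFunction.continuous_partialDeriv {η : EuclideanSpace ℝ (Fin d) → ℝ}
    (hη : IsTestFunction D η) (i : Fin d) : Continuous (partialDeriv i η) :=
  hη.continuous_fderiv.clm_apply continuous_const

theorem norm_fderiv_le_sum_partialDeriv (η : EuclideanSpace ℝ (Fin d) → ℝ)
    (x : EuclideanSpace ℝ (Fin d)) :
    ‖fderiv ℝ η x‖ ≤ ∑ i, ‖partialDeriv i η x‖ := by
  refine ContinuousLinearMap.opNorm_le_bound _ (by positivity) fun v => ?_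
  have hv : v = ∑ i, v i • EuclideanSpace.single i (1 : ℝ) := by
    have := (EuclideanSpace.basisFun (Fin d) ℝ).sum_repr v
    simpa using this.symm
  conv_lhs => rw [hv, map_sum]
  rw [Finset.sum_mul]
  refine (norm_sum_le _ _).trans (Finset.sum_le_sum fun i _ => ?_)
  rw [map_smul, norm_smul, mul_comm]
  exact mul_le_mul_of_nonneg_left (PiLp.norm_apply_le v i) (norm_nonneg _)

/-- In dimension one a compactly supported `C¹` function is bounded by the `L¹` norm of its
derivative. -/
theorem enorm_le_lintegral_fderiv_of_dim_one {η : EuclideanSpace ℝ (Fin 1) → ℝ}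
    (hη : ContDiff ℝ 1 η) (hc : HasCompactSupport η) (x : EuclideanSpace ℝ (Fin 1)) :
    ‖η x‖ₑ ≤ ∫⁻ y, ‖fderiv ℝ η y‖ₑ := by
  let e : ℝ ≃ₗᵢ[ℝ] EuclideanSpace ℝ (Fin 1) := (OrthonormalBasis.singleton (Fin 1) ℝ).repr
  have he : ContDiff ℝ 1 (η ∘ e) := hη.comp e.contDiff
  have hce : HasCompactSupport (η ∘ e) := hc.comp_homeomorph e.toHomeomorph
  have h1 := HasCompactSupport.enorm_le_lintegral_Ici_deriv he hce (e.symm x)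
  rw [Function.comp_apply, e.apply_symm_apply] at h1
  have h2 (t : ℝ) : ‖deriv (η ∘ e) t‖ₑ ≤ ‖fderiv ℝ η (e t)‖ₑ := by
    have h3 : HasFDerivAt (η ∘ e) ((fderiv ℝ η (e t)).comp
        (e : ℝ →L[ℝ] EuclideanSpace ℝ (Fin 1))) t :=
      ((hη.differentiable (by simp)).differentiableAt.hasFDerivAt).comp t e.hasFDerivAt
    rw [h3.hasDerivAt.deriv, enorm_le_iff_norm_le]
    refine (ContinuousLinearMap.le_opNorm _ _).trans ?_
    simp
  calc ‖η x‖ₑ ≤ ∫⁻ t in Set.Iic (e.symm x), ‖deriv (η ∘ e) t‖ₑ := h1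
    _ ≤ ∫⁻ t, ‖deriv (η ∘ e) t‖ₑ := setLIntegral_le_lintegral _ _
    _ ≤ ∫⁻ t, ‖fderiv ℝ η (e t)‖ₑ := lintegral_mono h2
    _ = ∫⁻ y, ‖fderiv ℝ η y‖ₑ :=
      e.measurePreserving.lintegral_comp_emb e.toHomeomorph.measurableEmbedding
        (fun y => ‖fderiv ℝ η y‖ₑ)

/-- The Sobolev inequality `‖η‖_{L^q(D)} ≤ K ‖∇η‖_{L²(D)}` for test functions, `q < ∞`, `d ≤ 2`. -/
theorem exists_eLpNorm_le_fderiv (hd : d = 1 ∨ d = 2) (hD : Bornology.IsBounded D) (q : ℝ≥0)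
    (hq : 2 ≤ q) : ∃ K : ℝ≥0∞, K ≠ ∞ ∧ ∀ η, IsTestFunction D η →
      eLpNorm η q (volume.restrict D) ≤ K * eLpNorm (fderiv ℝ η) 2 (volume.restrict D) := by
  have hfin : volume.restrict D Set.univ ≠ ∞ := by
    simpa using hD.measure_lt_top.ne
  rcases hd with rfl | rfl
  · refine ⟨volume.restrict D Set.univ ^ (2⁻¹ : ℝ) * volume.restrict D Set.univ ^ (q⁻¹ : ℝ),
      ENNReal.mul_ne_top (by finiteness) (by finiteness), fun η hη => ?_⟩
    have h1 : eLpNorm (fderiv ℝ η) 1 (volume.restrict D) ≤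
        eLpNorm (fderiv ℝ η) 2 (volume.restrict D) * volume.restrict D Set.univ ^ (2⁻¹ : ℝ) := by
      refine (eLpNorm_le_eLpNorm_mul_rpow_measure_univ one_le_two
        hη.continuous_fderiv.aestronglyMeasurable).trans (le_of_eq ?_)
      norm_num
    rw [hη.eLpNorm_fderiv_restrict,
      eLpNorm_one_eq_lintegral_enorm] at h1
    have h2 : eLpNorm η ∞ (volume.restrict D) ≤ ∫⁻ y, ‖fderiv ℝ η y‖ₑ :=
      essSup_le_of_ae_le _ (Eventually.of_forall
        (enorm_le_lintegral_fderiv_of_dim_one (hη.1.of_le (by simp)) hη.2.1))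
    calc eLpNorm η q (volume.restrict D)
        ≤ eLpNorm η ∞ (volume.restrict D) * volume.restrict D Set.univ ^ (q⁻¹ : ℝ) := by
          refine (eLpNorm_le_eLpNorm_mul_rpow_measure_univ le_top
            hη.1.continuous.aestronglyMeasurable).trans (le_of_eq ?_)
          simp
      _ ≤ (eLpNorm (fderiv ℝ η) 2 (volume.restrict D) * volume.restrict D Set.univ ^ (2⁻¹ : ℝ))
          * volume.restrict D Set.univ ^ (q⁻¹ : ℝ) := by gcongr; exact h2.trans h1
      _ = _ := by ring
  · have hq0 : (0 : ℝ) < q := lt_of_lt_of_le two_pos hq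
    -- This exponent solves $1/p-1/2=1/q$, the Sobolev relation in dimension two. It lies in
    -- $[1,2)$, so the $L^p$ norm of the gradient is controlled by its $L^2$ norm on the bounded
    -- domain.
    let p : ℝ≥0 := 2 * q / (2 + q)
    have hp : (p : ℝ) = 2 * q / (2 + q) := rfl
    have hq2 : (2 : ℝ) ≤ q := hq
    have hp1 : 1 ≤ p := by
      rw [← NNReal.coe_le_coe, hp, NNReal.coe_one, le_div_iff₀ (by positivity)]
      linarith
    have hp2 : p < 2 := by
      rw [← NNReal.coe_lt_coe, hp, NNReal.coe_ofNat, div_lt_iff₀ (by positivity)]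
      linarith
    have hpq : (p : ℝ)⁻¹ - (Module.finrank ℝ (EuclideanSpace ℝ (Fin 2)) : ℝ)⁻¹ ≤ (q : ℝ)⁻¹ := by
      rw [hp]
      simp
      field_simp
      linarith
    refine ⟨eLpNormLESNormFDerivOfLeConst ℝ volume D p q *
      volume.restrict D Set.univ ^ (1 / (p : ℝ) - 1 / 2), ?_, fun η hη => ?_⟩
    · refine ENNReal.mul_ne_top (by finiteness) (ENNReal.rpow_ne_top_of_nonneg ?_ hfin)
      rw [sub_nonneg]
      exact one_div_le_one_div_of_le (by positivity) (by exact_mod_cast hp2.le)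
    have h1 := eLpNorm_le_eLpNorm_fderiv_of_le volume (hη.1.of_le (by simp)) hη.support_subset
      hp1 (by simpa using hp2) hpq hD
    rw [eLpNorm_restrict_eq_of_support_subset hη.support_subset]
    refine h1.trans ?_
    rw [mul_assoc]
    gcongr
    rw [← hη.eLpNorm_fderiv_restrict, mul_comm]
    refine (eLpNorm_le_eLpNorm_mul_rpow_measure_univ (q := 2) (by exact_mod_cast hp2.le)
        hη.continuous_fderiv.aestronglyMeasurable).trans (le_of_eq ?_)
    simp

/-- `H¹₀(D) ⊆ L^q(D)` for `q < ∞`, `d ≤ 2`. -/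
theorem MemH10.memLp (hd : d = 1 ∨ d = 2) (hD : Bornology.IsBounded D) {u : L2 D}
    (hu : MemH10 D u) (q : ℝ≥0) (hq : 2 ≤ q) : MemLp u q (volume.restrict D) := by
  obtain ⟨K, hK, hsob⟩ := exists_eLpNorm_le_fderiv hd hD q hq
  obtain ⟨g, η, hη, hηu, hηg⟩ := hu
  refine ⟨Lp.aestronglyMeasurable u, ?_⟩
  -- A subsequence of the approximating test functions converges almost everywhere; their uniform
  -- $L^q$ bound passes to the limit by Fatou's lemma.
  obtain ⟨ns, hns, hlim⟩ := (tendstoInMeasure_of_tendsto_eLpNorm (p := 2) two_ne_zero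
    (fun n => (hη n).1.continuous.aestronglyMeasurable) (Lp.aestronglyMeasurable u)
    hηu).exists_seq_tendsto_ae
  have hbound : ∀ᶠ n in atTop, eLpNorm (η n) q (volume.restrict D) ≤
      K * ∑ i, (1 + eLpNorm (g i) 2 (volume.restrict D)) := by
    have h1 : ∀ᶠ n in atTop, ∀ i, eLpNorm (fun x => partialDeriv i (η n) x - g i x) 2
        (volume.restrict D) ≤ 1 := by
      rw [eventually_all]
      exact fun i => (hηg i).eventually_le_const one_pos
    filter_upwards [h1] with n hn
    refine (hsob _ (hη n)).trans ?_
    gcongr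
    calc eLpNorm (fderiv ℝ (η n)) 2 (volume.restrict D)
        ≤ eLpNorm (∑ i, fun x => ‖partialDeriv i (η n) x‖) 2 (volume.restrict D) := by
          refine eLpNorm_mono_real fun x => ?_
          simpa using norm_fderiv_le_sum_partialDeriv (η n) x
      _ ≤ ∑ i, eLpNorm (fun x => ‖partialDeriv i (η n) x‖) 2 (volume.restrict D) :=
          eLpNorm_sum_le (fun i _ =>
            ((hη n).continuous_partialDeriv i).norm.aestronglyMeasurable) one_le_two
      _ ≤ ∑ i, (1 + eLpNorm (g i) 2 (volume.restrict D)) := by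
          refine Finset.sum_le_sum fun i _ => ?_
          rw [eLpNorm_norm]
          have h2 : partialDeriv i (η n) =
              (fun x => partialDeriv i (η n) x - g i x) + g i := by
            ext x
            simp
          conv_lhs => rw [h2]
          refine (eLpNorm_add_le (((hη n).continuous_partialDeriv i).aestronglyMeasurable.sub
            (Lp.aestronglyMeasurable _)) (Lp.aestronglyMeasurable _) one_le_two).trans ?_
          gcongr
          exact hn i
  refine (Lp.eLpNorm_lim_le_liminf_eLpNorm
    (fun n => (hη (ns n)).1.continuous.aestronglyMeasurable) u hlim).trans_lt ?_
  refine (liminf_le_of_frequently_le'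
    (hns.tendsto_atTop.eventually hbound).frequently).trans_lt ?_
  refine ENNReal.mul_lt_top hK.lt_top (ENNReal.sum_lt_top.2 fun i _ => ?_)
  exact ENNReal.add_lt_top.2 ⟨ENNReal.one_lt_top, Lp.eLpNorm_lt_top _⟩

end Sobolev

/-! ### The nonlinearity on the Galerkin space: integrability, one-sided Lipschitz bound,
continuity. -/

section Nemytskij

variable {f : ℝ → ℝ} {C₀ C₁ C₂ C₃ γ : ℝ}

theorem IsDamping.differentiable (hf : IsDamping f C₀ C₁ C₂ C₃ γ) : Differentiable ℝ f :=
  hf.contDiff.differentiable (by norm_num)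

theorem IsDamping.continuous (hf : IsDamping f C₀ C₁ C₂ C₃ γ) : Continuous f :=
  hf.contDiff.continuous

theorem IsDamping.abs_apply_le (hf : IsDamping f C₀ C₁ C₂ C₃ γ) (v : ℝ) :
    |f v| ≤ (|f 0| + 2 * C₂) * (1 + |v| ^ γ) := by
  have hC := hf.C₂_pos.le
  have hγ := hf.two_le
  have h1 : |f v - f 0| ≤ C₂ * (1 + |v| ^ (γ - 1)) * |v| := by
    have h := (convex_Icc (-|v|) |v|).norm_image_sub_le_of_norm_deriv_le (𝕜 := ℝ) (f := f)
      (C := C₂ * (1 + |v| ^ (γ - 1))) (fun x _ => hf.differentiable x)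
      (fun x hx => (hf.abs_deriv_le x).trans ?_) (x := 0) (y := v) (by simp)
      (by simp [neg_abs_le, le_abs_self])
    · simpa using h
    · have hx' : |x| ≤ |v| := abs_le.2 hx
      gcongr
      linarith
  have h2 : |v| ^ (γ - 1) * |v| = |v| ^ γ := by
    rw [← Real.rpow_add_one' (abs_nonneg v) (by linarith), sub_add_cancel]
  have h3 : |v| ≤ 1 + |v| ^ γ := by
    rcases le_total |v| 1 with h | h
    · have := Real.rpow_nonneg (abs_nonneg v) γ
      linarith
    · have := Real.rpow_le_rpow_of_exponent_le h (by linarith : (1 : ℝ) ≤ γ)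
      rw [Real.rpow_one] at this
      linarith
  have h4 : |f v| ≤ |f 0| + |f v - f 0| := by
    have := abs_add_le (f 0) (f v - f 0)
    simpa using this
  have h5 : C₂ * (1 + |v| ^ (γ - 1)) * |v| = C₂ * (|v| + |v| ^ γ) := by
    rw [← h2]
    ring
  have h6 : 0 ≤ |v| ^ γ := Real.rpow_nonneg (abs_nonneg v) γ
  have h7 : 0 ≤ |f 0| := abs_nonneg _
  nlinarith [mul_le_mul_of_nonneg_left h3 hC, mul_nonneg h7 h6]

theorem IsDamping.sub_mul_sub_le (hf : IsDamping f C₀ C₁ C₂ C₃ γ) (a b : ℝ) :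
    (f a - f b) * (a - b) ≤ C₁ * (a - b) ^ 2 := by
  rcases le_total a b with h | h
  · have := image_sub_le_mul_sub_of_deriv_le hf.differentiable hf.deriv_le h
    nlinarith
  · have := image_sub_le_mul_sub_of_deriv_le hf.differentiable hf.deriv_le h
    nlinarith

variable {d : ℕ} {D : Set (EuclideanSpace ℝ (Fin d))}

theorem IsDamping.memLp_comp (hf : IsDamping f C₀ C₁ C₂ C₃ γ)
    {μ : Measure (EuclideanSpace ℝ (Fin d))} [IsFiniteMeasure μ] {v : EuclideanSpace ℝ (Fin d) → ℝ}
    (hv : MemLp v (2 * γ.toNNReal : ℝ≥0) μ) : MemLp (fun x => 1 + |v x| ^ γ) 2 μ ∧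
      MemLp (fun x => f (v x)) 2 μ := by
  have hγ := hf.two_le
  have h0 : (γ.toNNReal : ℝ≥0∞) ≠ 0 := by simp; linarith
  have h1 := hv.norm_rpow_div γ.toNNReal
  rw [ENNReal.coe_mul, ENNReal.mul_div_cancel_right h0 ENNReal.coe_ne_top] at h1
  simp only [ENNReal.coe_toReal, Real.coe_toNNReal γ (by linarith), Real.norm_eq_abs] at h1
  have h2 : MemLp (fun x => 1 + |v x| ^ γ) 2 μ := (memLp_const (1 : ℝ)).add h1
  refine ⟨h2, (h2.const_mul (|f 0| + 2 * C₂)).mono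
    (hf.continuous.comp_aestronglyMeasurable hv.1) (Eventually.of_forall fun x => ?_)⟩
  rw [Real.norm_eq_abs, Real.norm_eq_abs]
  exact (hf.abs_apply_le _).trans (le_abs_self _)

variable {lam : ℕ → ℝ} {φ : HilbertBasis ℕ ℝ (L2 D)}

theorem IsDirichletEigensystem.memLp (hφ : IsDirichletEigensystem D lam φ)
    (hd : d = 1 ∨ d = 2) (hD : IsSmoothBoundedDomain D) (q : ℝ≥0) (hq : 2 ≤ q) (j : ℕ) :
    MemLp (φ j) q (volume.restrict D) :=
  (hφ.eigen j).1.memLp hd hD.isBounded q hq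

theorem coeFn_sum_basis (φ : HilbertBasis ℕ ℝ (L2 D)) (N : ℕ) (c : ℕ → ℝ) :
    ∀ᵐ x ∂volume.restrict D, (∑ j ∈ Finset.range N, c j • φ j : L2 D) x =
      ∑ j ∈ Finset.range N, c j * φ j x := by
  have h : ∀ᵐ x ∂volume.restrict D, ∀ j, (c j • φ j : L2 D) x = c j * φ j x := by
    rw [ae_all_iff]
    exact fun j => Lp.coeFn_smul (c j) (φ j)
  filter_upwards [h, Lp.coeFn_finsetSum (Finset.range N) fun j => c j • φ j] with x hx hs
  rw [hs, Finset.sum_apply]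
  exact Finset.sum_congr rfl fun j _ => hx j

theorem coeFn_of_mem {N : ℕ} {v : L2 D} (hv : v ∈ galerkinSpace φ N) :
    ∀ᵐ x ∂volume.restrict D, v x = ∑ j ∈ Finset.range N, inner ℝ (φ j) v * φ j x := by
  conv =>
    enter [1, x]
    rw [eq_sum_of_mem φ hv]
  filter_upwards [coeFn_sum_basis φ N fun j => inner ℝ (φ j) v] with x hx
  rw [hx, ← eq_sum_of_mem φ hv]

theorem memLp_sum_basis {q : ℝ≥0∞} (h : ∀ j, MemLp (φ j) q (volume.restrict D)) (N : ℕ)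
    (c : ℕ → ℝ) :
    MemLp (fun x => ∑ j ∈ Finset.range N, c j * φ j x) q (volume.restrict D) :=
  memLp_finsetSum _ fun j _ => (h j).const_mul (c j)

/-- This rules out the default value $0$ in `nemytskij`: eigenfunctions lie in $L^{2\gamma}$ by the
Sobolev embedding, and $f$ grows at most like $|v|^\gamma$. -/
theorem memLp_nemytskij (hd : d = 1 ∨ d = 2) (hD : IsSmoothBoundedDomain D)
    (hφ : IsDirichletEigensystem D lam φ) (hf : IsDamping f C₀ C₁ C₂ C₃ γ) {N : ℕ} {v : L2 D}
    (hv : v ∈ galerkinSpace φ N) : MemLp (fun x => f (v x)) 2 (volume.restrict D) := by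
  have : IsFiniteMeasure (volume.restrict D) := ⟨by simpa using hD.isBounded.measure_lt_top⟩
  refine (hf.memLp_comp ?_).2
  refine (memLp_congr_ae (coeFn_of_mem hv)).2 (memLp_sum_basis (fun j => hφ.memLp hd hD _ ?_ j) N _)
  have h1 : (1 : ℝ≥0) ≤ γ.toNNReal := by
    rw [Real.one_le_toNNReal]
    linarith [hf.two_le]
  simpa using mul_le_mul_of_nonneg_left h1 (zero_le (a := (2 : ℝ≥0)))

theorem coeFn_nemytskij (hd : d = 1 ∨ d = 2) (hD : IsSmoothBoundedDomain D)
    (hφ : IsDirichletEigensystem D lam φ) (hf : IsDamping f C₀ C₁ C₂ C₃ γ) {N : ℕ} {v : L2 D}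
    (hv : v ∈ galerkinSpace φ N) :
    ∀ᵐ x ∂volume.restrict D, nemytskij f v x = f (v x) := by
  have h := memLp_nemytskij hd hD hφ hf hv
  rw [nemytskij, dif_pos h]
  exact h.coeFn_toLp

/-- `P_N F` is one-sided Lipschitz on `U_N`. -/
theorem inner_nemytskij_sub_le (hd : d = 1 ∨ d = 2) (hD : IsSmoothBoundedDomain D)
    (hφ : IsDirichletEigensystem D lam φ) (hf : IsDamping f C₀ C₁ C₂ C₃ γ) {N : ℕ} {v w : L2 D}
    (hv : v ∈ galerkinSpace φ N) (hw : w ∈ galerkinSpace φ N) :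
    inner ℝ (projN φ N (nemytskij f v) - projN φ N (nemytskij f w)) (v - w) ≤
      C₁ * ‖v - w‖ ^ 2 := by
  -- The projection drops out because $v-w\in U_N$; what remains is the pointwise inequality for
  -- $f$, integrated over the domain.
  rw [← map_sub, inner_projN_left φ _ (Submodule.sub_mem _ hv hw), ← real_inner_self_eq_norm_sq,
    L2.inner_def, L2.inner_def, ← integral_const_mul]
  refine integral_mono_ae (L2.integrable_inner _ _) ((L2.integrable_inner _ _).const_mul _) ?_
  filter_upwards [coeFn_nemytskij hd hD hφ hf hv, coeFn_nemytskij hd hD hφ hf hw,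
    Lp.coeFn_sub v w, Lp.coeFn_sub (nemytskij f v) (nemytskij f w)] with x h1 h2 h3 h4
  have := hf.sub_mul_sub_le (v x) (w x)
  simp only [h3, h4, Pi.sub_apply, h1, h2, RCLike.inner_apply, conj_trivial]
  linarith

/-- A continuous extension to `U` of the map `P_N F` on `U_N`. -/
noncomputable def galerkinDrift (φ : HilbertBasis ℕ ℝ (L2 D)) (f : ℝ → ℝ) (N : ℕ) (v : L2 D) :
    L2 D :=
  ∑ i ∈ Finset.range N,
    (∫ x in D, φ i x * f (∑ j ∈ Finset.range N, inner ℝ (φ j) v * φ j x)) • φ i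

theorem projN_nemytskij (hd : d = 1 ∨ d = 2) (hD : IsSmoothBoundedDomain D)
    (hφ : IsDirichletEigensystem D lam φ) (hf : IsDamping f C₀ C₁ C₂ C₃ γ) {N : ℕ} {v : L2 D}
    (hv : v ∈ galerkinSpace φ N) : projN φ N (nemytskij f v) = galerkinDrift φ f N v := by
  rw [projN, diagOp_apply, galerkinDrift]
  refine Finset.sum_congr rfl fun i _ => ?_
  rw [one_mul, L2.inner_def]
  congr 1
  refine integral_congr_ae ?_
  filter_upwards [coeFn_nemytskij hd hD hφ hf hv, coeFn_of_mem hv] with x h1 h2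
  simp [h1, ← h2, mul_comm]

/-- `nemytskij` takes a default value off a subset of $L^2$, so continuity is proved for the
extension in coordinates. It supplies both the measurability in $\omega$ and the integrability in
time of the drift. -/
theorem continuous_galerkinDrift (hd : d = 1 ∨ d = 2) (hD : IsSmoothBoundedDomain D)
    (hφ : IsDirichletEigensystem D lam φ) (hf : IsDamping f C₀ C₁ C₂ C₃ γ) (N : ℕ) :
    Continuous (galerkinDrift φ f N) := by
  have : IsFiniteMeasure (volume.restrict D) := ⟨by simpa using hD.isBounded.measure_lt_top⟩
  have hq : 2 ≤ 2 * γ.toNNReal := by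
    have h1 : (1 : ℝ≥0) ≤ γ.toNNReal := by
      rw [Real.one_le_toNNReal]
      linarith [hf.two_le]
    simpa using mul_le_mul_of_nonneg_left h1 (zero_le (a := (2 : ℝ≥0)))
  have hL := hφ.memLp hd hD _ hq
  refine continuous_finsetSum _ fun i _ => ?_
  suffices h : Continuous fun v : L2 D =>
      ∫ x in D, φ i x * f (∑ j ∈ Finset.range N, inner ℝ (φ j) v * φ j x) from
    h.smul continuous_const
  refine continuous_iff_continuousAt.2 fun v₀ => ?_
  -- This bounds every coordinate of $v$ in the closed unit ball around $v_0$, which gives a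
  -- dominating function independent of $v$.
  let R : ℝ := ‖v₀‖ + 1
  let b : EuclideanSpace ℝ (Fin d) → ℝ := fun x => ∑ j ∈ Finset.range N, R * |φ j x|
  have hb : MemLp b (2 * γ.toNNReal : ℝ≥0) (volume.restrict D) :=
    memLp_finsetSum _ fun j _ => (hL j).abs.const_mul R
  refine continuousAt_of_dominated
    (bound := fun x => |φ i x| * ((|f 0| + 2 * C₂) * (1 + |b x| ^ γ))) ?_ ?_ ?_ ?_
  · exact Eventually.of_forall fun v => (Lp.aestronglyMeasurable _).mul
      (hf.continuous.comp_aestronglyMeasurable (memLp_sum_basis hL N _).1)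
  · filter_upwards [Metric.closedBall_mem_nhds v₀ one_pos] with v hv
    refine Eventually.of_forall fun x => ?_
    rw [norm_mul, Real.norm_eq_abs, Real.norm_eq_abs]
    gcongr
    have hs : |∑ j ∈ Finset.range N, inner ℝ (φ j) v * φ j x| ≤ |b x| := by
      refine (Finset.abs_sum_le_sum_abs _ _).trans ((Finset.sum_le_sum fun j _ => ?_).trans
        (le_abs_self (b x)))
      rw [abs_mul]
      gcongr
      refine (abs_real_inner_le_norm _ _).trans ?_
      rw [φ.orthonormal.1 j, one_mul]
      have h1 : ‖v - v₀‖ ≤ 1 := by simpa [dist_eq_norm] using hv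
      have h2 := norm_le_norm_add_norm_sub' v v₀
      simp only [R]
      linarith
    have hC := hf.C₂_pos.le
    have hγ : 0 ≤ γ := zero_le_two.trans hf.two_le
    have := Real.rpow_le_rpow (abs_nonneg _) hs hγ
    refine (hf.abs_apply_le _).trans ?_
    gcongr
  · exact (Lp.memLp (φ i)).abs.integrable_mul ((hf.memLp_comp hb).1.const_mul _)
  · refine Eventually.of_forall fun x => Continuous.continuousAt ?_
    have := hf.continuous
    fun_prop

end Nemytskij

/-! ### Uniqueness, linearity and additivity of the stochastic integral. -/

section StochIntegral

variable {U H H' Ω : Type*} [NormedAddCommGroup U] [InnerProductSpace ℝ U]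
  [NormedAddCommGroup H] [NormedSpace ℝ H] [NormedAddCommGroup H'] [NormedSpace ℝ H']
  {mΩ : MeasurableSpace Ω} {μ : Measure Ω} {W : ℝ≥0 → Ω → U} {Φ : ℝ≥0 → U →L[ℝ] H}
  {a b c T : ℝ≥0} {I J : Ω → H}

theorem exists_partition (hab : a ≤ b) {δ : ℝ≥0} (hδ : 0 < δ) :
    ∃ (n : ℕ) (p : ℕ → ℝ≥0), Monotone p ∧ p 0 = a ∧ p n = b ∧ ∀ k, p (k + 1) ≤ p k + δ := by
  obtain ⟨n, hn⟩ := exists_nat_ge (b / δ)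
  refine ⟨n, fun k => min (a + k * δ) b, fun i j hij => ?_, by simpa using hab, ?_, fun k => ?_⟩
  · have : (i : ℝ≥0) ≤ j := by exact_mod_cast hij
    dsimp only
    gcongr
  · rw [div_le_iff₀ hδ] at hn
    exact min_eq_right (hn.trans le_add_self)
  · dsimp only
    rw [← min_add_add_right]
    refine min_le_min ?_ le_self_add
    push_cast
    exact le_of_eq (by ring)

theorem aestronglyMeasurable_partition_sum (hW : ∀ t ≤ T, AEStronglyMeasurable (W t) μ)
    (Φ : ℝ≥0 → U →L[ℝ] H) {p : ℕ → ℝ≥0} (hp : Monotone p) {n : ℕ} (hn : p n ≤ T) :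
    AEStronglyMeasurable
      (fun ω => ∑ k ∈ Finset.range n, Φ (p k) (W (p (k + 1)) ω - W (p k) ω)) μ := by
  refine Finset.aestronglyMeasurable_fun_sum _ fun k hk => ?_
  have hk' : k + 1 ≤ n := Finset.mem_range.1 hk
  exact (Φ (p k)).continuous.comp_aestronglyMeasurable
    ((hW _ ((hp hk').trans hn)).sub (hW _ ((hp (k.le_succ.trans hk')).trans hn)))

/-- Both candidates are close in $L^2$ to the same Riemann sum, taken over a partition fine enough
for each. -/
theorem HasStochIntegral.ae_eq (hW : ∀ t ≤ T, AEStronglyMeasurable (W t) μ) (hab : a ≤ b)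
    (hb : b ≤ T) (hI : HasStochIntegral μ W Φ a b I) (hJ : HasStochIntegral μ W Φ a b J) :
    I =ᵐ[μ] J := by
  have h0 : eLpNorm (I - J) 2 μ = 0 := by
    refine le_antisymm (ENNReal.le_of_forall_pos_le_add fun ε hε _ => ?_) zero_le
    obtain ⟨δ₁, hδ₁, h₁⟩ := hI.2 (ε / 2) (by positivity)
    obtain ⟨δ₂, hδ₂, h₂⟩ := hJ.2 (ε / 2) (by positivity)
    obtain ⟨n, p, hp, hp0, hpn, hpδ⟩ := exists_partition hab (lt_min hδ₁ hδ₂)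
    have h₁' := h₁ n p hp hp0 hpn fun k _ => (hpδ k).trans (by gcongr; exact min_le_left _ _)
    have h₂' := h₂ n p hp hp0 hpn fun k _ => (hpδ k).trans (by gcongr; exact min_le_right _ _)
    have hS := aestronglyMeasurable_partition_sum hW Φ hp (hpn.le.trans hb)
    set S := fun ω => ∑ k ∈ Finset.range n, Φ (p k) (W (p (k + 1)) ω - W (p k) ω)
    have h3 : I - J = (fun ω => S ω - J ω) - fun ω => S ω - I ω := by
      ext ω
      simp
    calc eLpNorm (I - J) 2 μ ≤ ENNReal.ofReal (ε / 2) + ENNReal.ofReal (ε / 2) := by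
          rw [h3]
          exact (eLpNorm_sub_le (hS.sub hJ.1.1) (hS.sub hI.1.1) one_le_two).trans
            (add_le_add h₂' h₁')
      _ = 0 + ε := by
          rw [← ENNReal.ofReal_add (by positivity) (by positivity), add_halves, zero_add,
            ENNReal.ofReal_coe_nnreal]
  rw [eLpNorm_eq_zero_iff (hI.1.1.sub hJ.1.1) two_ne_zero] at h0
  filter_upwards [h0] with ω h
  exact sub_eq_zero.1 h

theorem HasStochIntegral.map (L : H →L[ℝ] H') (hI : HasStochIntegral μ W Φ a b I) :
    HasStochIntegral μ W (fun s => L.comp (Φ s)) a b (fun ω => L (I ω)) := by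
  refine ⟨L.comp_memLp' hI.1, fun ε hε => ?_⟩
  have hL : 0 < ‖L‖ + 1 := by positivity
  obtain ⟨δ, hδ, h⟩ := hI.2 (ε / (‖L‖ + 1)) (by positivity)
  refine ⟨δ, hδ, fun n p hp hp0 hpn hpδ => ?_⟩
  have h1 := h n p hp hp0 hpn hpδ
  refine (eLpNorm_le_mul_eLpNorm_of_ae_le_mul (c := ‖L‖ + 1) (g := fun ω =>
    (∑ k ∈ Finset.range n, Φ (p k) (W (p (k + 1)) ω - W (p k) ω)) - I ω)
    (Eventually.of_forall fun ω => ?_) 2).trans ?_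
  · simp only [ContinuousLinearMap.comp_apply, ← map_sum, ← map_sub]
    refine (L.le_opNorm _).trans ?_
    gcongr
    simp
  · calc _ ≤ ENNReal.ofReal (‖L‖ + 1) * ENNReal.ofReal (ε / (‖L‖ + 1)) := by gcongr
      _ = ENNReal.ofReal ε := by
        rw [← ENNReal.ofReal_mul hL.le, mul_div_cancel₀ _ hL.ne']

/-- Prepending a fine partition of $[a,b]$ to one of $[b,c]$ gives a partition of $[a,c]$, and the
Riemann sums add. -/
theorem HasStochIntegral.sub_interval (hW : ∀ t ≤ T, AEStronglyMeasurable (W t) μ) (hab : a ≤ b)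
    (hbc : b ≤ c) (hc : c ≤ T) (hI : HasStochIntegral μ W Φ a c I)
    (hJ : HasStochIntegral μ W Φ a b J) : HasStochIntegral μ W Φ b c (I - J) := by
  refine ⟨hI.1.sub hJ.1, fun ε hε => ?_⟩
  obtain ⟨δ₁, hδ₁, h₁⟩ := hI.2 (ε / 2) (by positivity)
  obtain ⟨δ₂, hδ₂, h₂⟩ := hJ.2 (ε / 2) (by positivity)
  refine ⟨δ₁, hδ₁, fun n p hp hp0 hpn hpδ => ?_⟩
  obtain ⟨l, q, hq, hq0, hql, hqδ⟩ := exists_partition hab (lt_min hδ₁ hδ₂)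
  let r : ℕ → ℝ≥0 := fun k => if k < l then q k else p (k - l)
  have hrq (k : ℕ) (hk : k ≤ l) : r k = q k := by
    rcases hk.lt_or_eq with h | rfl
    · exact if_pos h
    · simp [r, hp0, hql]
  have hrp (k : ℕ) : r (l + k) = p k := by simp [r]
  have hr : Monotone r := by
    refine monotone_nat_of_le_succ fun k => ?_
    rcases lt_or_ge k l with h | h
    · rw [hrq k h.le, hrq (k + 1) h]
      exact hq k.le_succ
    · obtain ⟨j, rfl⟩ := Nat.exists_eq_add_of_le h
      rw [add_assoc, hrp, hrp]
      exact hp j.le_succ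
  have h₁' := h₁ (l + n) r hr (by rw [hrq 0 (Nat.zero_le _), hq0]) (by rw [hrp, hpn])
    fun k hk => by
      rcases lt_or_ge k l with h | h
      · rw [hrq k h.le, hrq (k + 1) h]
        exact (hqδ k).trans (by gcongr; exact min_le_left _ _)
      · obtain ⟨j, rfl⟩ := Nat.exists_eq_add_of_le h
        rw [add_assoc, hrp, hrp]
        exact hpδ j (by omega)
  have h₂' := h₂ l q hq hq0 hql fun k _ => (hqδ k).trans (by gcongr; exact min_le_right _ _)
  have hSq := aestronglyMeasurable_partition_sum hW Φ hq (hql.le.trans (hbc.trans hc))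
  have hSr := aestronglyMeasurable_partition_sum hW Φ hr (n := l + n) (by rw [hrp, hpn]; exact hc)
  have hsplit (ω : Ω) :
      (∑ k ∈ Finset.range n, Φ (p k) (W (p (k + 1)) ω - W (p k) ω)) =
      (∑ k ∈ Finset.range (l + n), Φ (r k) (W (r (k + 1)) ω - W (r k) ω)) -
        ∑ k ∈ Finset.range l, Φ (q k) (W (q (k + 1)) ω - W (q k) ω) := by
    rw [Finset.sum_range_add, eq_sub_iff_add_eq, add_comm]
    congr 1
    · refine Finset.sum_congr rfl fun k hk => ?_
      have hk' := Finset.mem_range.1 hk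
      rw [hrq k hk'.le, hrq (k + 1) hk']
    · refine Finset.sum_congr rfl fun k hk => ?_
      rw [add_assoc, hrp, hrp]
  have h3 : (fun ω => (∑ k ∈ Finset.range n, Φ (p k) (W (p (k + 1)) ω - W (p k) ω)) - (I - J) ω) =
      (fun ω => (∑ k ∈ Finset.range (l + n), Φ (r k) (W (r (k + 1)) ω - W (r k) ω)) - I ω) -
        fun ω => (∑ k ∈ Finset.range l, Φ (q k) (W (q (k + 1)) ω - W (q k) ω)) - J ω := by
    ext ω
    simp only [hsplit, Pi.sub_apply]
    abel
  rw [h3]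
  refine (eLpNorm_sub_le (hSr.sub hI.1.1) (hSq.sub hJ.1.1) one_le_two).trans
    ((add_le_add h₁' h₂').trans (le_of_eq ?_))
  rw [← ENNReal.ofReal_add (by positivity) (by positivity), add_halves]

theorem HasStochIntegral.stochIntegral (hI : HasStochIntegral μ W Φ a b I) :
    HasStochIntegral μ W Φ a b (stochIntegral μ W Φ a b) := by
  have h : ∃ I, HasStochIntegral μ W Φ a b I := ⟨I, hI⟩
  rw [DampedWave.stochIntegral, dif_pos h]
  exact h.choose_spec

end StochIntegral

/-! ### The one-step recursion of the exact semi-discrete solution. -/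

section Recursion

variable {d : ℕ} {D : Set (EuclideanSpace ℝ (Fin d))} {Ω : Type*} {mΩ : MeasurableSpace Ω}
  {lam : ℕ → ℝ} {φ : HilbertBasis ℕ ℝ (L2 D)} {f : ℝ → ℝ} {C₀ C₁ C₂ C₃ γ : ℝ}
  {μ : Measure Ω} {ℱ : Filtration ℝ≥0 mΩ} {T : ℝ≥0} {W : ℝ≥0 → Ω → L2 D}
  {u₀ v₀ : Ω → L2 D} {N M : ℕ} {X : ℝ≥0 → Ω → L2 D × L2 D}

theorem continuousOn_groupN_apply (lam : ℕ → ℝ) (φ : HilbertBasis ℕ ℝ (L2 D)) (N : ℕ)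
    {α : Type*} [TopologicalSpace α] {s : Set α} {g : α → ℝ} {x : α → L2 D × L2 D}
    (hg : ContinuousOn g s) (hx : ContinuousOn x s) :
    ContinuousOn (fun a => groupN lam φ N (g a) (x a)) s := by
  have h1 : ContinuousOn (fun a => (groupN lam φ N (g a) (x a)).1) s := by
    simp only [groupN_fst, diagOp_apply]
    fun_prop
  have h2 : ContinuousOn (fun a => (groupN lam φ N (g a) (x a)).2) s := by
    simp only [groupN_snd, diagOp_apply]
    fun_prop
  exact h1.prodMk h2

theorem projN_mem (φ : HilbertBasis ℕ ℝ (L2 D)) (N : ℕ) (u : L2 D) :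
    projN φ N u ∈ galerkinSpace φ N :=
  diagOp_mem φ N _ u

theorem driftN_of_mem (hd : d = 1 ∨ d = 2) (hD : IsSmoothBoundedDomain D)
    (hφ : IsDirichletEigensystem D lam φ) (hf : IsDamping f C₀ C₁ C₂ C₃ γ)
    {x : L2 D × L2 D} (hx : x ∈ galerkinProd φ N) :
    driftN φ f N x = (0, galerkinDrift φ f N x.2) := by
  rw [driftN, projN_nemytskij hd hD hφ hf hx.2]

theorem driftN_mem (φ : HilbertBasis ℕ ℝ (L2 D)) (f : ℝ → ℝ) (N : ℕ) (x : L2 D × L2 D) :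
    driftN φ f N x ∈ galerkinProd φ N :=
  ⟨Submodule.zero_mem _, projN_mem φ N _⟩

theorem continuous_drift (hd : d = 1 ∨ d = 2) (hD : IsSmoothBoundedDomain D)
    (hφ : IsDirichletEigensystem D lam φ) (hf : IsDamping f C₀ C₁ C₂ C₃ γ) (N : ℕ) :
    Continuous fun x : L2 D × L2 D => ((0 : L2 D), galerkinDrift φ f N x.2) :=
  continuous_const.prodMk ((continuous_galerkinDrift hd hD hφ hf N).comp continuous_snd)

theorem IsGalerkinSolution.mem_galerkinProd
    (hX : IsGalerkinSolution lam φ f μ ℱ T W u₀ v₀ N X) {t : ℝ≥0} (ht : t ≤ T) (ω : Ω) :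
    X t ω ∈ galerkinProd φ N := hX.mem t ht ω

theorem IsGalerkinSolution.intervalIntegrable (hd : d = 1 ∨ d = 2) (hD : IsSmoothBoundedDomain D)
    (hφ : IsDirichletEigensystem D lam φ) (hf : IsDamping f C₀ C₁ C₂ C₃ γ)
    (hX : IsGalerkinSolution lam φ f μ ℱ T W u₀ v₀ N X) {ω : Ω}
    (hω : ContinuousOn (fun t => X t ω) (Set.Iic T)) (r : ℝ) {a b : ℝ≥0} (ha : a ≤ T)
    (hb : b ≤ T) :
    IntervalIntegrable (fun s : ℝ => groupN lam φ N (r - s) (driftN φ f N (X s.toNNReal ω)))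
      volume a b := by
  have h1 : ContinuousOn
      (fun s : ℝ => groupN lam φ N (r - s) (0, galerkinDrift φ f N (X s.toNNReal ω).2))
      (Set.Iic T) := by
    have h3 : ContinuousOn (fun s : ℝ => X s.toNNReal ω) (Set.Iic T) :=
      hω.comp continuous_real_toNNReal.continuousOn fun s hs =>
        Real.toNNReal_le_iff_le_coe.2 hs
    have h4 : ContinuousOn (fun s : ℝ => ((0 : L2 D), galerkinDrift φ f N (X s.toNNReal ω).2))
        (Set.Iic T) := (continuous_drift hd hD hφ hf N).comp_continuousOn h3
    have h5 : ContinuousOn (fun s : ℝ => r - s) (Set.Iic T) := by fun_prop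
    exact continuousOn_groupN_apply lam φ N h5 h4
  have h2 : ContinuousOn
      (fun s : ℝ => groupN lam φ N (r - s) (driftN φ f N (X s.toNNReal ω))) (Set.Iic T) := by
    refine h1.congr fun s hs => ?_
    rw [driftN_of_mem hd hD hφ hf
      (hX.mem_galerkinProd (Real.toNNReal_le_iff_le_coe.2 hs) ω)]
  refine (h2.mono fun s hs => ?_).intervalIntegrable
  exact hs.2.trans (sup_le (NNReal.coe_le_coe.2 ha) (NNReal.coe_le_coe.2 hb))

/-- Apply $E_N(r-t)$ to the mild formula at time $t$ and subtract it from the one at time $r$. By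
the group property the integrands on $[0,t]$ agree and cancel. -/
theorem IsGalerkinSolution.exists_stochIntegral
    (hW : ∀ t ≤ T, AEStronglyMeasurable (W t) μ) (hd : d = 1 ∨ d = 2)
    (hD : IsSmoothBoundedDomain D)
    (hφ : IsDirichletEigensystem D lam φ) (hf : IsDamping f C₀ C₁ C₂ C₃ γ)
    (hX : IsGalerkinSolution lam φ f μ ℱ T W u₀ v₀ N X) {t r : ℝ≥0} (htr : t ≤ r) (hr : r ≤ T) :
    ∃ I : Ω → L2 D × L2 D, HasStochIntegral μ W
        (fun s => (groupN lam φ N ((r : ℝ) - s)).comp (noiseN φ N)) t r I ∧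
      ∀ᵐ ω ∂μ, X r ω = groupN lam φ N (r - t) (X t ω)
        + (∫ s in (t : ℝ)..r, groupN lam φ N (r - s) (driftN φ f N (X s.toNNReal ω))) + I ω := by
  obtain ⟨I, hI, hIX⟩ := hX.mild r hr
  obtain ⟨J, hJ, hJX⟩ := hX.mild t (htr.trans hr)
  have hcomp : (fun s : ℝ≥0 => (groupN lam φ N ((r : ℝ) - t)).comp
      ((groupN lam φ N ((t : ℝ) - s)).comp (noiseN φ N))) =
      fun s : ℝ≥0 => (groupN lam φ N ((r : ℝ) - s)).comp (noiseN φ N) := by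
    ext1 s
    refine ContinuousLinearMap.ext fun w => ?_
    simp only [ContinuousLinearMap.comp_apply]
    rw [← groupN_add, sub_add_sub_cancel]
  have hJ' := hJ.map (groupN lam φ N ((r : ℝ) - t))
  rw [hcomp] at hJ'
  refine ⟨_, hI.sub_interval hW zero_le htr hr hJ', ?_⟩
  filter_upwards [hIX, hJX, hX.continuous_paths] with ω h1 h2 hω
  have htT := htr.trans hr
  have hint0 (ρ : ℝ) : IntervalIntegrable (fun s : ℝ =>
      groupN lam φ N (ρ - s) (driftN φ f N (X s.toNNReal ω))) volume 0 t := by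
    simpa using hX.intervalIntegrable hd hD hφ hf hω ρ (zero_le (a := T)) htT
  have h3 : groupN lam φ N (r - t) (∫ s in (0 : ℝ)..t,
      groupN lam φ N (t - s) (driftN φ f N (X s.toNNReal ω))) =
      ∫ s in (0 : ℝ)..t, groupN lam φ N (r - s) (driftN φ f N (X s.toNNReal ω)) := by
    rw [← ContinuousLinearMap.intervalIntegral_comp_comm _ (hint0 t)]
    simp only [← groupN_add, sub_add_sub_cancel]
  have h4 : (∫ s in (0 : ℝ)..r, groupN lam φ N (r - s) (driftN φ f N (X s.toNNReal ω))) =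
      (∫ s in (0 : ℝ)..t, groupN lam φ N (r - s) (driftN φ f N (X s.toNNReal ω))) +
      ∫ s in (t : ℝ)..r, groupN lam φ N (r - s) (driftN φ f N (X s.toNNReal ω)) :=
    (intervalIntegral.integral_add_adjacent_intervals (hint0 r)
      (hX.intervalIntegrable hd hD hφ hf hω r htT hr)).symm
  rw [h1, h2, map_add, map_add, h3, h4, ← groupN_add, sub_add_cancel, Pi.sub_apply]
  abel

theorem gridPt_mono (T : ℝ≥0) (M : ℕ) : Monotone (gridPt T M) := fun i j hij => by
  have : (i : ℝ≥0) ≤ j := by exact_mod_cast hij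
  unfold gridPt
  gcongr

theorem gridPt_self (T : ℝ≥0) (hM : 0 < M) : gridPt T M M = T := by
  have : (M : ℝ≥0) ≠ 0 := by exact_mod_cast hM.ne'
  rw [gridPt, mul_div_cancel₀ _ this]

theorem gridPt_le (T : ℝ≥0) {m : ℕ} (hm : m ≤ M) (hM : 0 < M) : gridPt T M m ≤ T :=
  (gridPt_mono T M hm).trans_eq (gridPt_self T hM)

theorem gridPt_succ_sub (T : ℝ≥0) (M m : ℕ) :
    (gridPt T M (m + 1) : ℝ) - gridPt T M m = T / M := by
  simp only [gridPt]
  push_cast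
  ring

theorem energyInv_energyMap_noise (lam : ℕ → ℝ) (φ : HilbertBasis ℕ ℝ (L2 D)) (N : ℕ) (t : ℝ)
    (w : L2 D) :
    energyInv lam φ N (energyMap lam φ N (groupN lam φ N t (noiseN φ N w))) =
      groupN lam φ N t (noiseN φ N w) :=
  energyInv_energyMap_groupN lam φ N t (projN φ N w)

/-- The one-step recursion satisfied by the exact semi-discrete solution, and the fact that the
remainder is determined by its energy coordinates. -/
theorem IsGalerkinSolution.step
    (hW : ∀ t ≤ T, AEStronglyMeasurable (W t) μ) (hd : d = 1 ∨ d = 2)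
    (hD : IsSmoothBoundedDomain D)
    (hφ : IsDirichletEigensystem D lam φ) (hf : IsDamping f C₀ C₁ C₂ C₃ γ)
    (hX : IsGalerkinSolution lam φ f μ ℱ T W u₀ v₀ N X) {m : ℕ} (hm : m < M) :
    ∀ᵐ ω ∂μ, X (gridPt T M (m + 1)) ω = groupN lam φ N ((T : ℝ) / M) (X (gridPt T M m) ω)
        + ((T : ℝ) / M) • driftN φ f N (X (gridPt T M (m + 1)) ω)
        + groupN lam φ N ((T : ℝ) / M)
          (noiseN φ N (W (gridPt T M (m + 1)) ω - W (gridPt T M m) ω))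
        + remainder lam φ f μ T W N M X m ω ∧
      energyInv lam φ N (energyMap lam φ N (remainder lam φ f μ T W N M X m ω)) =
        remainder lam φ f μ T W N M X m ω := by
  have hM : 0 < M := (Nat.zero_le m).trans_lt hm
  have htr : gridPt T M m ≤ gridPt T M (m + 1) := gridPt_mono T M m.le_succ
  have hr : gridPt T M (m + 1) ≤ T := gridPt_le T hm hM
  obtain ⟨I, hI, hIX⟩ := hX.exists_stochIntegral hW hd hD hφ hf htr hr
  have hS := hI.stochIntegral
  -- The integral inside the remainder is an arbitrary $L^2$ version. Its image under `energyInv`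
  -- after `energyMap` is another version of the same integral, since the integrand is fixed by that
  -- map, so uniqueness identifies the two almost surely.
  have hSL := hS.map ((energyInv lam φ N).comp (energyMap lam φ N))
  have hcomp : (fun s : ℝ≥0 => ((energyInv lam φ N).comp (energyMap lam φ N)).comp
      ((groupN lam φ N ((gridPt T M (m + 1) : ℝ) - s)).comp (noiseN φ N))) =
      fun s : ℝ≥0 => (groupN lam φ N ((gridPt T M (m + 1) : ℝ) - s)).comp (noiseN φ N) := by
    ext1 s
    exact ContinuousLinearMap.ext fun w => energyInv_energyMap_noise lam φ N _ w
  rw [hcomp] at hSL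
  filter_upwards [hIX, hS.ae_eq hW htr hr hI, hSL.ae_eq hW htr hr hS, hX.continuous_paths]
    with ω h1 h2 h3 hω
  have hint := hX.intervalIntegrable hd hD hφ hf hω (gridPt T M (m + 1)) (htr.trans hr) hr
  have hsub : IntervalIntegrable (fun s : ℝ =>
      groupN lam φ N (gridPt T M (m + 1) - s) (driftN φ f N (X s.toNNReal ω))
      - driftN φ f N (X (gridPt T M (m + 1)) ω)) volume (gridPt T M m) (gridPt T M (m + 1)) :=
    hint.sub intervalIntegrable_const
  constructor
  · rw [remainder, intervalIntegral.integral_sub hint intervalIntegrable_const,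
      intervalIntegral.integral_const, gridPt_succ_sub, h2]
    conv_lhs => rw [h1, gridPt_succ_sub]
    abel
  · rw [remainder, map_sub, map_sub, map_add, map_add, energyInv_energyMap_noise]
    congr 2
    · rw [← ContinuousLinearMap.comp_apply,
        ← ContinuousLinearMap.intervalIntegral_comp_comm _ hsub]
      congr 1
      ext1 s
      rw [ContinuousLinearMap.comp_apply, map_sub, map_sub, driftN, driftN,
        energyInv_energyMap_groupN, energyInv_energyMap_snd lam φ (projN_mem φ N _)]

end Recursion

/-! ### Mean-square error propagation and discrete Gronwall estimate. -/

section ErrorRecursion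

variable {Ω G : Type*} {mΩ : MeasurableSpace Ω} {μ : Measure Ω}
  [NormedAddCommGroup G] [InnerProductSpace ℝ G]

/-- With $z=\tau\delta+r$ one has $\|e\|^2=\|x\|^2+2\langle z,e\rangle-\|z\|^2$. The term $2\langle
r,z\rangle$ contained in $2\langle z,e\rangle$ costs $\|r\|^2+\|z\|^2$, and $-\|z\|^2$ absorbs the
second part exactly. Hence no bound on $\|\delta\|$ is needed. -/
theorem norm_sq_implicit_step_le {e x r δ : G} {τ c : ℝ} (hτ : 0 ≤ τ) (he : e = x + τ • δ + r)
    (hδ : inner ℝ δ e ≤ c * ‖e‖ ^ 2) :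
    (1 - 2 * (τ * c)) * ‖e‖ ^ 2 ≤ ‖x‖ ^ 2 + ‖r‖ ^ 2 + 2 * inner ℝ r x := by
  obtain ⟨z, hz⟩ : ∃ z, z = τ • δ + r := ⟨_, rfl⟩
  have he' : e = x + z := by rw [he, hz, add_assoc]
  have h1 : inner ℝ z e = τ * inner ℝ δ e + inner ℝ r e := by
    rw [hz, inner_add_left, real_inner_smul_left]
  have h2 : inner ℝ r e = inner ℝ r x + inner ℝ r z := by rw [he', inner_add_right]
  have h3 : inner ℝ z e = inner ℝ x z + ‖z‖ ^ 2 := by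
    rw [he', inner_add_right, real_inner_self_eq_norm_sq, real_inner_comm]
  have h4 : ‖e‖ ^ 2 = ‖x‖ ^ 2 + 2 * inner ℝ x z + ‖z‖ ^ 2 := by
    rw [he', norm_add_sq_real]
  have h5 : 2 * inner ℝ r z ≤ ‖r‖ ^ 2 + ‖z‖ ^ 2 := by
    have := real_inner_le_norm r z
    nlinarith [sq_nonneg (‖r‖ - ‖z‖)]
  have h6 := mul_le_mul_of_nonneg_left hδ hτ
  linarith

theorem lintegral_enorm_sq_eq_ofReal {G : Type*} [NormedAddCommGroup G] {g : Ω → G}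
    (hg : MemLp g 2 μ) : ∫⁻ ω, ‖g ω‖ₑ ^ 2 ∂μ = ENNReal.ofReal (∫ ω, ‖g ω‖ ^ 2 ∂μ) := by
  rw [ofReal_integral_eq_lintegral_ofReal ((memLp_two_iff_integrable_sq_norm hg.1).1 hg)
    (Eventually.of_forall fun ω => by positivity)]
  refine lintegral_congr fun ω => ?_
  rw [ENNReal.ofReal_pow (norm_nonneg _), ofReal_norm]

theorem memLp_two_of_lintegral_enorm_sq {G : Type*} [NormedAddCommGroup G] {g : Ω → G}
    (hg : AEStronglyMeasurable g μ) (h : ∫⁻ ω, ‖g ω‖ₑ ^ 2 ∂μ ≠ ∞) : MemLp g 2 μ := by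
  refine ⟨hg, ?_⟩
  rw [eLpNorm_lt_top_iff_lintegral_rpow_enorm_lt_top two_ne_zero ENNReal.ofNat_ne_top]
  simpa using h.lt_top

theorem integrable_inner_of_memLp_two {g h : Ω → G} (hg : MemLp g 2 μ) (hh : MemLp h 2 μ) :
    Integrable (fun ω => inner ℝ (g ω) (h ω)) μ := by
  refine (hg.norm.integrable_mul hh.norm).mono (hg.1.inner hh.1) (Eventually.of_forall fun ω => ?_)
  simpa using norm_inner_le_norm (𝕜 := ℝ) (g ω) (h ω)

theorem integral_inner_condExp [CompleteSpace G] [IsProbabilityMeasure μ] {m : MeasurableSpace Ω}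
    (hm : m ≤ mΩ) {g h : Ω → G} (hg : MemLp g 2 μ) (hh : MemLp h 2 μ)
    (hhm : AEStronglyMeasurable[m] h μ) :
    ∫ ω, inner ℝ (g ω) (h ω) ∂μ = ∫ ω, inner ℝ ((μ[g | m]) ω) (h ω) ∂μ := by
  rw [← integral_condExp hm]
  exact integral_congr_ae (condExp_bilin_of_aestronglyMeasurable_right (innerSL ℝ) hhm
    (integrable_inner_of_memLp_two hg hh) (hg.integrable one_le_two))

theorem one_le_exp_mul_one_sub {x : ℝ} (h0 : 0 ≤ x) (h1 : 3 * x ≤ 1) :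
    1 ≤ Real.exp (3 / 2 * x) * (1 - x) := by
  have h2 := Real.add_one_le_exp (3 / 2 * x)
  nlinarith

/-- Error propagation for one implicit step, in mean square. -/
theorem integral_norm_sq_step_le [CompleteSpace G] [IsProbabilityMeasure μ]
    {m : MeasurableSpace Ω} (hm : m ≤ mΩ) {ε ε' ξ δ ρ : Ω → G} {τ c : ℝ} (hτ : 0 < τ) (hc : 0 ≤ c)
    (hτc : 6 * c * τ ≤ 1) (hstep : ∀ᵐ ω ∂μ, ε' ω = ξ ω + τ • δ ω + ρ ω)
    (hξε : ∀ᵐ ω ∂μ, ‖ξ ω‖ = ‖ε ω‖)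
    (hδ : ∀ᵐ ω ∂μ, inner ℝ (δ ω) (ε' ω) ≤ c * ‖ε' ω‖ ^ 2)
    (hξ : AEStronglyMeasurable[m] ξ μ) (hε' : AEStronglyMeasurable[mΩ] ε' μ)
    (hρ : MemLp ρ 2 μ) (hε : MemLp ε 2 μ) :
    MemLp ε' 2 μ ∧ ∫ ω, ‖ε' ω‖ ^ 2 ∂μ ≤ Real.exp ((3 * c + 1) * τ) *
      (∫ ω, ‖ε ω‖ ^ 2 ∂μ + (∫ ω, ‖ρ ω‖ ^ 2 ∂μ + τ⁻¹ * ∫ ω, ‖(μ[ρ | m]) ω‖ ^ 2 ∂μ)) := by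
  have hξ2 : MemLp ξ 2 μ := (memLp_congr_norm (hξ.mono hm) hε.1 hξε).2 hε
  have hη := hρ.condExp (m := m) one_le_two
  have hI (g : Ω → G) (hg : MemLp g 2 μ) : Integrable (fun ω => ‖g ω‖ ^ 2) μ :=
    (memLp_two_iff_integrable_sq_norm hg.1).1 hg
  have hκ : 0 < 1 - 2 * (τ * c) := by linarith
  have hpath : ∀ᵐ ω ∂μ, (1 - 2 * (τ * c)) * ‖ε' ω‖ ^ 2 ≤
      ‖ε ω‖ ^ 2 + ‖ρ ω‖ ^ 2 + 2 * inner ℝ (ρ ω) (ξ ω) := by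
    filter_upwards [hstep, hξε, hδ] with ω h1 h2 h3
    rw [← h2]
    exact norm_sq_implicit_step_le hτ.le h1 h3
  have hRint : Integrable (fun ω => ‖ε ω‖ ^ 2 + ‖ρ ω‖ ^ 2 + 2 * inner ℝ (ρ ω) (ξ ω)) μ :=
    ((hI ε hε).add (hI ρ hρ)).add ((integrable_inner_of_memLp_two hρ hξ2).const_mul 2)
  -- Integrability of the new error comes from the pathwise bound, as its coefficient $1-2\tau c$ is
  -- positive.
  have hε'2 : MemLp ε' 2 μ := by
    refine (memLp_two_iff_integrable_sq_norm hε').2 ?_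
    refine (hRint.const_mul (1 - 2 * (τ * c))⁻¹).mono (hε'.norm.pow 2) ?_
    filter_upwards [hpath] with ω h
    rw [Real.norm_of_nonneg (by positivity)]
    refine le_trans ?_ (le_abs_self _)
    rwa [inv_mul_eq_div, le_div_iff₀' hκ]
  refine ⟨hε'2, ?_⟩
  have h1 : (1 - 2 * (τ * c)) * ∫ ω, ‖ε' ω‖ ^ 2 ∂μ ≤ ∫ ω, ‖ε ω‖ ^ 2 ∂μ + ∫ ω, ‖ρ ω‖ ^ 2 ∂μ +
      2 * ∫ ω, inner ℝ (ρ ω) (ξ ω) ∂μ := by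
    have hsum : Integrable (fun ω => ‖ε ω‖ ^ 2 + ‖ρ ω‖ ^ 2) μ := (hI ε hε).add (hI ρ hρ)
    rw [← integral_const_mul, ← integral_const_mul, ← integral_add (hI ε hε) (hI ρ hρ),
      ← integral_add hsum ((integrable_inner_of_memLp_two hρ hξ2).const_mul 2)]
    exact integral_mono_ae ((hI ε' hε'2).const_mul _) hRint hpath
  -- Conditioning on the past, to which $\xi$ belongs, and then Young's inequality with weight
  -- $\tau$: the old error is amplified only by $1+\tau$, at the price of $\tau^{-1}$ on the
  -- conditional mean.
  have h2 : 2 * ∫ ω, inner ℝ (ρ ω) (ξ ω) ∂μ ≤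
      τ⁻¹ * ∫ ω, ‖(μ[ρ | m]) ω‖ ^ 2 ∂μ + τ * ∫ ω, ‖ε ω‖ ^ 2 ∂μ := by
    rw [integral_inner_condExp hm hρ hξ2 hξ, ← integral_const_mul, ← integral_const_mul,
      ← integral_const_mul, ← integral_add ((hI _ hη).const_mul _) ((hI ε hε).const_mul _)]
    refine integral_mono_ae ((integrable_inner_of_memLp_two hη hξ2).const_mul 2)
      (((hI _ hη).const_mul _).add ((hI ε hε).const_mul _)) ?_
    filter_upwards [hξε] with ω h
    rw [← h]
    have h3 := real_inner_le_norm ((μ[ρ | m]) ω) (ξ ω)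
    have h4 : τ⁻¹ * ‖(μ[ρ | m]) ω‖ ^ 2 + τ * ‖ξ ω‖ ^ 2 - 2 * (‖(μ[ρ | m]) ω‖ * ‖ξ ω‖) =
        τ⁻¹ * (‖(μ[ρ | m]) ω‖ - τ * ‖ξ ω‖) ^ 2 := by
      field_simp
      ring
    have h5 : 0 ≤ τ⁻¹ * (‖(μ[ρ | m]) ω‖ - τ * ‖ξ ω‖) ^ 2 := by positivity
    linarith
  have ha' : 0 ≤ ∫ ω, ‖ε' ω‖ ^ 2 ∂μ := integral_nonneg fun ω => by positivity
  have ha : 0 ≤ ∫ ω, ‖ε ω‖ ^ 2 ∂μ := integral_nonneg fun ω => by positivity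
  have hr : 0 ≤ ∫ ω, ‖ρ ω‖ ^ 2 ∂μ := integral_nonneg fun ω => by positivity
  have hs : 0 ≤ τ⁻¹ * ∫ ω, ‖(μ[ρ | m]) ω‖ ^ 2 ∂μ :=
    mul_nonneg (by positivity) (integral_nonneg fun ω => by positivity)
  -- The step size restriction gives $2\tau c\le 1/3$, hence $(1-2\tau c)^{-1}\le e^{3\tau c}$. With
  -- $1+\tau\le e^\tau$ the growth factor per step is $e^{(3c+1)\tau}$.
  have h3 := one_le_exp_mul_one_sub (x := 2 * (τ * c)) (by positivity) (by linarith)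
  have h4 := Real.add_one_le_exp τ
  have h5 : Real.exp ((3 * c + 1) * τ) = Real.exp (3 / 2 * (2 * (τ * c))) * Real.exp τ := by
    rw [← Real.exp_add]
    ring_nf
  have h6 : (1 - 2 * (τ * c)) * ∫ ω, ‖ε' ω‖ ^ 2 ∂μ ≤ Real.exp τ *
      (∫ ω, ‖ε ω‖ ^ 2 ∂μ + (∫ ω, ‖ρ ω‖ ^ 2 ∂μ + τ⁻¹ * ∫ ω, ‖(μ[ρ | m]) ω‖ ^ 2 ∂μ)) := by
    generalize (∫ ω, ‖ρ ω‖ ^ 2 ∂μ) = r at *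
    generalize τ⁻¹ * (∫ ω, ‖(μ[ρ | m]) ω‖ ^ 2 ∂μ) = s at *
    nlinarith [mul_le_mul_of_nonneg_right h4 (add_nonneg ha (add_nonneg hr hs)),
      mul_nonneg hτ.le hr, mul_nonneg hτ.le hs]
  rw [h5, mul_assoc]
  calc ∫ ω, ‖ε' ω‖ ^ 2 ∂μ = 1 * ∫ ω, ‖ε' ω‖ ^ 2 ∂μ := (one_mul _).symm
    _ ≤ (Real.exp (3 / 2 * (2 * (τ * c))) * (1 - 2 * (τ * c))) * ∫ ω, ‖ε' ω‖ ^ 2 ∂μ := by gcongr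
    _ = Real.exp (3 / 2 * (2 * (τ * c))) * ((1 - 2 * (τ * c)) * ∫ ω, ‖ε' ω‖ ^ 2 ∂μ) := by ring
    _ ≤ _ := by gcongr

/-- Discrete Gronwall estimate for the mean square error of an implicit scheme. -/
theorem integral_norm_sq_le_sum [CompleteSpace G] [IsProbabilityMeasure μ]
    {𝒢 : ℕ → MeasurableSpace Ω} (h𝒢 : ∀ k, 𝒢 k ≤ mΩ) {ε ξ δ ρ : ℕ → Ω → G} {τ c : ℝ}
    (hτ : 0 < τ) (hc : 0 ≤ c) (hτc : 6 * c * τ ≤ 1) (n : ℕ)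
    (hε0 : ε 0 =ᵐ[μ] 0)
    (hstep : ∀ k < n, ∀ᵐ ω ∂μ, ε (k + 1) ω = ξ k ω + τ • δ k ω + ρ k ω)
    (hξε : ∀ k < n, ∀ᵐ ω ∂μ, ‖ξ k ω‖ = ‖ε k ω‖)
    (hδ : ∀ k < n, ∀ᵐ ω ∂μ, inner ℝ (δ k ω) (ε (k + 1) ω) ≤ c * ‖ε (k + 1) ω‖ ^ 2)
    (hξ : ∀ k < n, AEStronglyMeasurable[𝒢 k] (ξ k) μ)
    (hε : ∀ k < n, AEStronglyMeasurable (ε (k + 1)) μ)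
    (hρ : ∀ k < n, MemLp (ρ k) 2 μ) :
    MemLp (ε n) 2 μ ∧ ∫ ω, ‖ε n ω‖ ^ 2 ∂μ ≤ Real.exp (n * ((3 * c + 1) * τ)) *
      ∑ k ∈ Finset.range n, (∫ ω, ‖ρ k ω‖ ^ 2 ∂μ + τ⁻¹ * ∫ ω, ‖(μ[ρ k | 𝒢 k]) ω‖ ^ 2 ∂μ) := by
  induction n with
  | zero =>
    refine ⟨(memLp_congr_ae hε0).2 MemLp.zero', ?_⟩
    have : ∫ ω, ‖ε 0 ω‖ ^ 2 ∂μ = ∫ ω, (0 : ℝ) ∂μ :=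
      integral_congr_ae (by filter_upwards [hε0] with ω h; simp [h])
    simp [this]
  | succ n ih =>
    obtain ⟨h1, h2⟩ := ih (fun k hk => hstep k (by omega)) (fun k hk => hξε k (by omega))
      (fun k hk => hδ k (by omega)) (fun k hk => hξ k (by omega)) (fun k hk => hε k (by omega))
      (fun k hk => hρ k (by omega))
    have hn := n.lt_succ_self
    obtain ⟨h3, h4⟩ := integral_norm_sq_step_le (h𝒢 n) hτ hc hτc (hstep n hn) (hξε n hn)
      (hδ n hn) (hξ n hn) (hε n hn) (hρ n hn) h1
    refine ⟨h3, h4.trans ?_⟩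
    rw [Finset.sum_range_succ]
    set S := ∑ k ∈ Finset.range n,
      (∫ ω, ‖ρ k ω‖ ^ 2 ∂μ + τ⁻¹ * ∫ ω, ‖(μ[ρ k | 𝒢 k]) ω‖ ^ 2 ∂μ)
    set s := ∫ ω, ‖ρ n ω‖ ^ 2 ∂μ + τ⁻¹ * ∫ ω, ‖(μ[ρ n | 𝒢 n]) ω‖ ^ 2 ∂μ with hs
    have hs0 : 0 ≤ s := by
      have : 0 ≤ ∫ ω, ‖(μ[ρ n | 𝒢 n]) ω‖ ^ 2 ∂μ := integral_nonneg fun ω => by positivity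
      have : 0 ≤ ∫ ω, ‖ρ n ω‖ ^ 2 ∂μ := integral_nonneg fun ω => by positivity
      positivity
    have h5 : 1 ≤ Real.exp (n * ((3 * c + 1) * τ)) := Real.one_le_exp (by positivity)
    have h6 : Real.exp (((n + 1 : ℕ) : ℝ) * ((3 * c + 1) * τ)) =
        Real.exp ((3 * c + 1) * τ) * Real.exp (n * ((3 * c + 1) * τ)) := by
      rw [← Real.exp_add]
      push_cast
      ring_nf
    rw [h6, mul_assoc]
    gcongr
    rw [mul_add]
    gcongr
    exact le_mul_of_one_le_left hs0 h5

theorem lintegral_enorm_sq_le_sum [CompleteSpace G] [IsProbabilityMeasure μ]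
    {𝒢 : ℕ → MeasurableSpace Ω} (h𝒢 : ∀ k, 𝒢 k ≤ mΩ) {ε ξ δ ρ : ℕ → Ω → G} {τ c : ℝ}
    (hτ : 0 < τ) (hc : 0 ≤ c) (hτc : 6 * c * τ ≤ 1) (n : ℕ)
    (hε0 : ε 0 =ᵐ[μ] 0)
    (hstep : ∀ k < n, ∀ᵐ ω ∂μ, ε (k + 1) ω = ξ k ω + τ • δ k ω + ρ k ω)
    (hξε : ∀ k < n, ∀ᵐ ω ∂μ, ‖ξ k ω‖ = ‖ε k ω‖)
    (hδ : ∀ k < n, ∀ᵐ ω ∂μ, inner ℝ (δ k ω) (ε (k + 1) ω) ≤ c * ‖ε (k + 1) ω‖ ^ 2)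
    (hξ : ∀ k < n, AEStronglyMeasurable[𝒢 k] (ξ k) μ)
    (hε : ∀ k < n, AEStronglyMeasurable (ε (k + 1)) μ)
    (hρ : ∀ k < n, MemLp (ρ k) 2 μ) :
    ∫⁻ ω, ‖ε n ω‖ₑ ^ 2 ∂μ ≤ ENNReal.ofReal (Real.exp (n * ((3 * c + 1) * τ))) *
      ((∑ k ∈ Finset.range n, ∫⁻ ω, ‖ρ k ω‖ₑ ^ 2 ∂μ) + ENNReal.ofReal τ⁻¹ *
        ∑ k ∈ Finset.range n, ∫⁻ ω, ‖(μ[ρ k | 𝒢 k]) ω‖ₑ ^ 2 ∂μ) := by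
  obtain ⟨h1, h2⟩ := integral_norm_sq_le_sum h𝒢 hτ hc hτc n hε0 hstep hξε hδ hξ hε hρ
  rw [lintegral_enorm_sq_eq_ofReal h1]
  refine (ENNReal.ofReal_le_ofReal h2).trans (le_of_eq ?_)
  have h3 (g : Ω → G) : 0 ≤ ∫ ω, ‖g ω‖ ^ 2 ∂μ := integral_nonneg fun ω => by positivity
  rw [ENNReal.ofReal_mul (Real.exp_pos _).le, Finset.sum_add_distrib, ← Finset.mul_sum,
    ENNReal.ofReal_add (Finset.sum_nonneg fun k _ => h3 _)
      (mul_nonneg (by positivity) (Finset.sum_nonneg fun k _ => h3 _)),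
    ENNReal.ofReal_mul (by positivity), ENNReal.ofReal_sum_of_nonneg fun k _ => h3 _,
    ENNReal.ofReal_sum_of_nonneg fun k _ => h3 _]
  rw [Finset.sum_congr rfl fun k hk => lintegral_enorm_sq_eq_ofReal (hρ k (Finset.mem_range.1 hk)),
    Finset.sum_congr rfl fun k hk =>
      lintegral_enorm_sq_eq_ofReal ((hρ k (Finset.mem_range.1 hk)).condExp one_le_two)]

end ErrorRecursion

/-! ### Adaptedness of the implicit scheme and measurability of the remainder. -/

section Measurability

/-- If `Z = g(V)` with `g` strongly monotone on a finite-dimensional subspace containing the values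
of `V`, then `V` is measurable with respect to `Z`. -/
theorem aestronglyMeasurable_of_strongly_monotone {Ω E : Type*} {m mΩ : MeasurableSpace Ω}
    {μ : Measure[mΩ] Ω} [NormedAddCommGroup E] [InnerProductSpace ℝ E] {K : Submodule ℝ E}
    [FiniteDimensional ℝ K] {g : E → E} {a : ℝ} (ha : 0 < a)
    (hg : ∀ v ∈ K, ∀ w ∈ K, a * ‖v - w‖ ^ 2 ≤ inner ℝ (g v - g w) (v - w)) {V Z : Ω → E}
    (hV : ∀ᵐ ω ∂μ, V ω ∈ K) (hZV : ∀ᵐ ω ∂μ, Z ω = g (V ω)) (hZ : AEStronglyMeasurable[m] Z μ) :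
    AEStronglyMeasurable[m] V μ := by
  have hlip (v w : K) : dist v w ≤ a⁻¹ * dist (g v) (g w) := by
    rw [dist_eq_norm, dist_eq_norm, inv_mul_eq_div, le_div_iff₀' ha]
    have h1 := (hg v v.2 w w.2).trans (real_inner_le_norm _ _)
    have h2 : ‖v - w‖ = ‖(v : E) - w‖ := rfl
    rw [h2]
    rcases (norm_nonneg ((v : E) - w)).eq_or_lt with h | h
    · rw [← h]
      simp
    · nlinarith
  -- Strong monotonicity makes any right inverse of $g$ on its range Lipschitz. Finite dimension of
  -- the target lets it be extended to the whole space, so neither surjectivity of $g$ nor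
  -- measurability of its range is needed.
  choose! r hr using fun (z : E) (hz : z ∈ Set.range fun v : K => g v) => hz
  replace hr : ∀ z ∈ Set.range fun v : K => g v, g (r z) = z := hr
  have hLip : LipschitzOnWith a⁻¹.toNNReal r (Set.range fun v : K => g v) := by
    refine LipschitzOnWith.of_dist_le_mul fun z hz w hw => ?_
    rw [Real.coe_toNNReal _ (by positivity)]
    have := hlip (r z) (r w)
    rwa [hr z hz, hr w hw] at this
  obtain ⟨s, hs, hrs⟩ := hLip.extend_finite_dimension
  have hsV : ∀ᵐ ω ∂μ, ((s (Z ω) : K) : E) = V ω := by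
    filter_upwards [hV, hZV] with ω h1 h2
    have hmem : Z ω ∈ Set.range fun v : K => g v := ⟨⟨V ω, h1⟩, h2.symm⟩
    have h3 := hlip (r (Z ω)) ⟨V ω, h1⟩
    rw [hr _ hmem, h2, dist_self, mul_zero] at h3
    rw [← hrs hmem, h2, dist_le_zero.1 h3]
  exact ((continuous_subtype_val.comp hs.continuous).comp_aestronglyMeasurable hZ).congr hsV

variable {d : ℕ} {D : Set (EuclideanSpace ℝ (Fin d))} {Ω : Type*} {mΩ : MeasurableSpace Ω}
  {lam : ℕ → ℝ} {φ : HilbertBasis ℕ ℝ (L2 D)} {f : ℝ → ℝ} {C₀ C₁ C₂ C₃ γ : ℝ}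
  {μ : Measure Ω} {ℱ : Filtration ℝ≥0 mΩ} {T : ℝ≥0} {W : ℝ≥0 → Ω → L2 D}
  {u₀ v₀ : Ω → L2 D} {N M : ℕ} {X : ℝ≥0 → Ω → L2 D × L2 D} {Y : ℕ → Ω → L2 D × L2 D}

instance finiteDimensional_galerkinSpace (φ : HilbertBasis ℕ ℝ (L2 D)) (N : ℕ) :
    FiniteDimensional ℝ (galerkinSpace φ N) := by
  refine FiniteDimensional.span_of_finite ℝ ?_
  refine ((Set.finite_lt_nat N).image φ).subset ?_
  rintro u ⟨i, hi, rfl⟩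
  exact ⟨i, hi, rfl⟩

theorem inner_projN_nemytskij_sub_le_max (hd : d = 1 ∨ d = 2) (hD : IsSmoothBoundedDomain D)
    (hφ : IsDirichletEigensystem D lam φ) (hf : IsDamping f C₀ C₁ C₂ C₃ γ) {v w : L2 D}
    (hv : v ∈ galerkinSpace φ N) (hw : w ∈ galerkinSpace φ N) :
    inner ℝ (projN φ N (nemytskij f v) - projN φ N (nemytskij f w)) (v - w) ≤
      max 0 C₁ * ‖v - w‖ ^ 2 :=
  (inner_nemytskij_sub_le hd hD hφ hf hv hw).trans
    (mul_le_mul_of_nonneg_right (le_max_right _ _) (sq_nonneg _))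

theorem IsEulerScheme.mem (hY : IsEulerScheme lam φ f μ T W u₀ v₀ N M Y) {m : ℕ} (hm : m ≤ M) :
    ∀ᵐ ω ∂μ, Y m ω ∈ galerkinProd φ N := by
  cases m with
  | zero =>
    filter_upwards [hY.initial] with ω h
    rw [h]
    exact ⟨projN_mem φ N _, projN_mem φ N _⟩
  | succ m =>
    filter_upwards [hY.step m hm] with ω h
    rw [h]
    exact Submodule.add_mem _ (Submodule.add_mem _ (groupN_mem _ _ _ _ _)
      (Submodule.smul_mem _ _ (driftN_mem _ _ _ _))) (groupN_mem _ _ _ _ _)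

theorem aestronglyMeasurable_noise
    (hW : ∀ t ≤ T, StronglyMeasurable[ℱ t] (W t)) (lam : ℕ → ℝ) (φ : HilbertBasis ℕ ℝ (L2 D))
    (N : ℕ) (r : ℝ) {m : ℕ} (hm : m < M) :
    AEStronglyMeasurable[ℱ (gridPt T M (m + 1))] (fun ω => groupN lam φ N r
      (noiseN φ N (W (gridPt T M (m + 1)) ω - W (gridPt T M m) ω))) μ := by
  have hM : 0 < M := (Nat.zero_le m).trans_lt hm
  have h1 := hW _ (gridPt_le T hm hM)
  have h2 := (hW _ (gridPt_le T hm.le hM)).mono (ℱ.mono (gridPt_mono T M m.le_succ))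
  exact ((groupN lam φ N r).comp (noiseN φ N)).continuous.comp_aestronglyMeasurable
    (h1.sub h2).aestronglyMeasurable

theorem IsEulerScheme.aestronglyMeasurable (hd : d = 1 ∨ d = 2) (hD : IsSmoothBoundedDomain D)
    (hφ : IsDirichletEigensystem D lam φ) (hf : IsDamping f C₀ C₁ C₂ C₃ γ)
    (hW : ∀ t ≤ T, StronglyMeasurable[ℱ t] (W t))
    (hu₀ : StronglyMeasurable[ℱ 0] u₀) (hv₀ : StronglyMeasurable[ℱ 0] v₀)
    (hτ : 6 * max 0 C₁ * ((T : ℝ) / M) ≤ 1)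
    (hY : IsEulerScheme lam φ f μ T W u₀ v₀ N M Y) {m : ℕ} (hm : m ≤ M) :
    AEStronglyMeasurable[ℱ (gridPt T M m)] (Y m) μ := by
  induction m with
  | zero =>
    have h0 : gridPt T M 0 = 0 := by simp [gridPt]
    rw [h0]
    have h1 : StronglyMeasurable[ℱ 0] fun ω => (projN φ N (u₀ ω), projN φ N (v₀ ω)) :=
      ((projN φ N).continuous.comp_stronglyMeasurable hu₀).prodMk
        ((projN φ N).continuous.comp_stronglyMeasurable hv₀)
    exact h1.aestronglyMeasurable.congr (hY.initial.mono fun ω h => h.symm)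
  | succ m ih =>
    have h1 := (ih (by omega)).mono (ℱ.mono (gridPt_mono T M m.le_succ))
    set τ : ℝ := (T : ℝ) / M
    have hτ0 : 0 ≤ τ := by positivity
    have hZ : AEStronglyMeasurable[ℱ (gridPt T M (m + 1))] (fun ω => groupN lam φ N τ (Y m ω) +
        groupN lam φ N τ (noiseN φ N (W (gridPt T M (m + 1)) ω - W (gridPt T M m) ω))) μ :=
      ((groupN lam φ N τ).continuous.comp_aestronglyMeasurable h1).add
        (aestronglyMeasurable_noise hW lam φ N τ hm)
    have hfst : AEStronglyMeasurable[ℱ (gridPt T M (m + 1))] (fun ω => (Y (m + 1) ω).1) μ := by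
      refine (continuous_fst.comp_aestronglyMeasurable hZ).congr ?_
      filter_upwards [hY.step m hm] with ω h
      rw [h]
      simp [driftN, τ]
    -- The velocity solves $v-\tau P_NF(v)=Z$ with $Z$ measurable at time $t_{m+1}$; the left side
    -- is strongly monotone with constant $1-\tau\max\{0,C_1\}>0$.
    have hsnd : AEStronglyMeasurable[ℱ (gridPt T M (m + 1))] (fun ω => (Y (m + 1) ω).2) μ := by
      refine aestronglyMeasurable_of_strongly_monotone (K := galerkinSpace φ N)
        (g := fun v => v - τ • projN φ N (nemytskij f v)) (a := 1 - τ * max 0 C₁) (by linarith)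
        (fun v hv w hw => ?_) ((hY.mem hm).mono fun ω h => h.2) ?_
        (continuous_snd.comp_aestronglyMeasurable hZ)
      · have h2 := mul_le_mul_of_nonneg_left
          (inner_projN_nemytskij_sub_le_max hd hD hφ hf hv hw) hτ0
        have h3 : v - τ • projN φ N (nemytskij f v) - (w - τ • projN φ N (nemytskij f w)) =
            (v - w) - τ • (projN φ N (nemytskij f v) - projN φ N (nemytskij f w)) := by
          rw [smul_sub]
          abel
        rw [h3, inner_sub_left, real_inner_smul_left, real_inner_self_eq_norm_sq]
        linarith
      · filter_upwards [hY.step m hm] with ω h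
        have h2 := congrArg Prod.snd h
        simp only [Prod.snd_add, Prod.smul_snd, driftN] at h2
        rw [Prod.snd_add, eq_sub_iff_add_eq]
        conv_rhs => rw [h2]
        abel
    exact hfst.prodMk hsnd

/-- Solving the one-step recursion for the remainder expresses it through measurable quantities, so
the time integral need not be treated as a function of $\omega$. -/
theorem IsGalerkinSolution.aestronglyMeasurable_remainder (hd : d = 1 ∨ d = 2)
    (hD : IsSmoothBoundedDomain D)
    (hφ : IsDirichletEigensystem D lam φ) (hf : IsDamping f C₀ C₁ C₂ C₃ γ)
    (hW : ∀ t ≤ T, StronglyMeasurable[ℱ t] (W t))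
    (hX : IsGalerkinSolution lam φ f μ ℱ T W u₀ v₀ N X) {m : ℕ} (hm : m < M) :
    AEStronglyMeasurable (remainder lam φ f μ T W N M X m) μ := by
  have hM : 0 < M := (Nat.zero_le m).trans_lt hm
  have hr := gridPt_le T (M := M) (m := m + 1) hm hM
  have h1 : AEStronglyMeasurable (X (gridPt T M m)) μ :=
    ((hX.adapted _ (gridPt_le T hm.le hM)).mono (ℱ.le _)).aestronglyMeasurable
  have h2 : AEStronglyMeasurable (X (gridPt T M (m + 1))) μ :=
    ((hX.adapted _ hr).mono (ℱ.le _)).aestronglyMeasurable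
  have h3 : AEStronglyMeasurable (fun ω => driftN φ f N (X (gridPt T M (m + 1)) ω)) μ := by
    refine ((continuous_drift hd hD hφ hf N).comp_aestronglyMeasurable h2).congr ?_
    exact Eventually.of_forall fun ω =>
      (driftN_of_mem hd hD hφ hf (hX.mem_galerkinProd hr ω)).symm
  have h4 := (aestronglyMeasurable_noise (μ := μ) hW lam φ N ((T : ℝ) / M) hm).mono (ℱ.le _)
  refine (((h2.sub ((groupN lam φ N ((T : ℝ) / M)).continuous.comp_aestronglyMeasurable h1)).sub
    (h3.const_smul ((T : ℝ) / M))).sub h4).congr ?_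
  filter_upwards [hX.step (fun t ht => ((hW t ht).mono (ℱ.le _)).aestronglyMeasurable)
    hd hD hφ hf hm] with ω h
  refine sub_eq_of_eq_add (sub_eq_of_eq_add (sub_eq_of_eq_add (h.1.trans ?_)))
  simp only [Pi.smul_apply]
  abel

end Measurability

end DampedWave

/-! ### Assembly of the error bound. -/

open DampedWave in
theorem mainTheorem4 {d : ℕ} (hd : d = 1 ∨ d = 2)
    (D : Set (EuclideanSpace ℝ (Fin d))) (hD : DampedWave.IsSmoothBoundedDomain D)
    (lam : ℕ → ℝ) (φ : HilbertBasis ℕ ℝ (DampedWave.L2 D))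
    (hφ : DampedWave.IsDirichletEigensystem D lam φ)
    (f : ℝ → ℝ) (C₀ C₁ C₂ C₃ γ : ℝ) (hf : DampedWave.IsDamping f C₀ C₁ C₂ C₃ γ)
    (Q S : DampedWave.L2 D →L[ℝ] DampedWave.L2 D)
    (hQ : DampedWave.IsNoiseCovariance lam φ Q S)
    {Ω : Type*} {mΩ : MeasurableSpace Ω} (μ : Measure Ω) [IsProbabilityMeasure μ]
    (ℱ : Filtration ℝ≥0 mΩ) (T : ℝ≥0) (hT : 0 < T)
    (W : ℝ≥0 → Ω → DampedWave.L2 D) (hW : DampedWave.IsQWiener μ ℱ Q T W)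
    (u₀ v₀ : Ω → DampedWave.L2 D)
    (hu₀ : StronglyMeasurable[ℱ 0] u₀) (hv₀ : StronglyMeasurable[ℱ 0] v₀) :
    ∃ C : ℝ, 0 < C ∧
      ∀ N M m : ℕ, 0 < N → m < M →
        -- the step size restriction `τ ≤ 1 / (6 max {0, C₁})`, void when `C₁ ≤ 0`
        6 * max 0 C₁ * ((T : ℝ) / M) ≤ 1 →
        ∀ X : ℝ≥0 → Ω → DampedWave.L2 D × DampedWave.L2 D,
          DampedWave.IsGalerkinSolution lam φ f μ ℱ T W u₀ v₀ N X →
          ∀ Y : ℕ → Ω → DampedWave.L2 D × DampedWave.L2 D,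
            DampedWave.IsEulerScheme lam φ f μ T W u₀ v₀ N M Y →
            ∫⁻ ω, DampedWave.prodNormSq lam φ 1
                (X (DampedWave.gridPt T M (m + 1)) ω - Y (m + 1) ω) ∂μ
              ≤ ENNReal.ofReal C *
                ((∑ i ∈ Finset.range (m + 1), ∫⁻ ω, DampedWave.prodNormSq lam φ 1
                    (DampedWave.remainder lam φ f μ T W N M X i ω) ∂μ)
                + ENNReal.ofReal (((T : ℝ) / M)⁻¹) *
                  ∑ i ∈ Finset.range (m + 1), ∫⁻ ω, DampedWave.prodNormSq lam φ 1
                    ((μ[DampedWave.remainder lam φ f μ T W N M X i |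
                      ℱ (DampedWave.gridPt T M i)]) ω) ∂μ) := by
  refine ⟨Real.exp ((3 * max 0 C₁ + 1) * T), Real.exp_pos _, ?_⟩
  intro N M m _ hm hτc X hX Y hY
  have hM : 0 < M := (Nat.zero_le m).trans_lt hm
  have hMR : (0 : ℝ) < M := by exact_mod_cast hM
  set τ : ℝ := (T : ℝ) / M with hτdef
  have hτ : 0 < τ := div_pos (by exact_mod_cast hT) hMR
  have hadp := hW.adapted
  have hWm : ∀ t ≤ T, AEStronglyMeasurable (W t) μ :=
    fun t ht => ((hadp t ht).mono (ℱ.le _)).aestronglyMeasurable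
  let J := energyMap lam φ N
  let R := remainder lam φ f μ T W N M X
  -- If some remainder has infinite second moment, the right-hand side is infinite, because the
  -- constant is positive.
  by_cases hfin : ∀ k ∈ Finset.range (m + 1), ∫⁻ ω, prodNormSq lam φ 1 (R k ω) ∂μ ≠ ∞
  swap
  · push Not at hfin
    obtain ⟨k, hk, hinf⟩ := hfin
    have hsum : ∑ i ∈ Finset.range (m + 1), ∫⁻ ω, prodNormSq lam φ 1 (R i ω) ∂μ = ∞ :=
      ENNReal.sum_eq_top.2 ⟨k, hk, hinf⟩
    rw [hsum, top_add, ENNReal.mul_top (by simp [Real.exp_pos])]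
    exact le_top
  have hkM {k : ℕ} (hk : k < m + 1) : k < M := by omega
  have hRm {k : ℕ} (hk : k < m + 1) : AEStronglyMeasurable (R k) μ :=
    hX.aestronglyMeasurable_remainder hd hD hφ hf hadp (hkM hk)
  have hρ : ∀ k < m + 1, MemLp (fun ω => J (R k ω)) 2 μ := fun k hk =>
    memLp_two_of_lintegral_enorm_sq (J.continuous.comp_aestronglyMeasurable (hRm hk))
      ((lintegral_mono fun ω => enorm_energyMap_sq_le lam φ N (R k ω)).trans_lt
        (hfin k (Finset.mem_range.2 hk)).lt_top).ne
  -- Needed to commute `J` with the conditional expectation. The moment bound controls only the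
  -- energy coordinates, from which `energyInv` recovers the remainder almost surely.
  have hRint {k : ℕ} (hk : k < m + 1) : Integrable (R k) μ := by
    refine (((energyInv lam φ N).comp_memLp' (hρ k hk)).integrable one_le_two).congr ?_
    filter_upwards [hX.step hWm hd hD hφ hf (hkM hk)] with ω h
    exact h.2
  have hcond {k : ℕ} (hk : k < m + 1) :
      ∫⁻ ω, ‖(μ[fun ω => J (R k ω) | ℱ (gridPt T M k)]) ω‖ₑ ^ 2 ∂μ ≤
        ∫⁻ ω, prodNormSq lam φ 1 ((μ[R k | ℱ (gridPt T M k)]) ω) ∂μ := by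
    refine lintegral_mono_ae ?_
    filter_upwards [J.comp_condExp_comm (m := ℱ (gridPt T M k)) (hRint hk)] with ω h
    have h' : (μ[fun ω => J (R k ω) | ℱ (gridPt T M k)]) ω =
        J ((μ[R k | ℱ (gridPt T M k)]) ω) := h.symm
    rw [h']
    exact enorm_energyMap_sq_le lam φ N _
  have hYm {k : ℕ} (hk : k ≤ M) := hY.aestronglyMeasurable hd hD hφ hf hadp hu₀ hv₀ hτc hk
  have hem {k : ℕ} (hk : k ≤ M) : AEStronglyMeasurable[ℱ (gridPt T M k)]
      (fun ω => X (gridPt T M k) ω - Y k ω) μ :=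
    (hX.adapted _ (gridPt_le T hk hM)).aestronglyMeasurable.sub (hYm hk)
  have hmain := lintegral_enorm_sq_le_sum (μ := μ) (𝒢 := fun k => ℱ (gridPt T M k))
    (fun k => ℱ.le _) (ε := fun k ω => J (X (gridPt T M k) ω - Y k ω))
    (ξ := fun k ω => J (groupN lam φ N τ (X (gridPt T M k) ω - Y k ω)))
    (δ := fun k ω => J (driftN φ f N (X (gridPt T M (k + 1)) ω) - driftN φ f N (Y (k + 1) ω)))
    (ρ := fun k ω => J (R k ω)) hτ (le_max_left 0 C₁) hτc (m + 1) ?_ ?_ ?_ ?_ ?_ ?_ hρ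
  · have hlhs : ∫⁻ ω, prodNormSq lam φ 1 (X (gridPt T M (m + 1)) ω - Y (m + 1) ω) ∂μ =
        ∫⁻ ω, ‖J (X (gridPt T M (m + 1)) ω - Y (m + 1) ω)‖ₑ ^ 2 ∂μ := by
      refine lintegral_congr_ae ?_
      filter_upwards [hY.mem hm] with ω h
      exact (enorm_energyMap_sq_eq lam φ
        (Submodule.sub_mem _ (hX.mem_galerkinProd (gridPt_le T hm hM) ω) h)).symm
    rw [hlhs]
    refine hmain.trans ?_
    refine mul_le_mul' (ENNReal.ofReal_le_ofReal (Real.exp_le_exp.2 ?_)) (add_le_add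
      (Finset.sum_le_sum fun k _ => lintegral_mono fun ω => enorm_energyMap_sq_le lam φ N _)
      (mul_le_mul' le_rfl (Finset.sum_le_sum fun k hk => hcond (Finset.mem_range.1 hk))))
    · have h1 : ((m + 1 : ℕ) : ℝ) * τ ≤ T := by
        have h2 : ((m + 1 : ℕ) : ℝ) ≤ M := by exact_mod_cast hm
        rw [hτdef, ← mul_div_assoc, div_le_iff₀ hMR, mul_comm]
        gcongr
      have h3 : 0 ≤ 3 * max 0 C₁ + 1 := by positivity
      calc ((m + 1 : ℕ) : ℝ) * ((3 * max 0 C₁ + 1) * τ)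
          = (3 * max 0 C₁ + 1) * (((m + 1 : ℕ) : ℝ) * τ) := by ring
        _ ≤ (3 * max 0 C₁ + 1) * T := by gcongr
  · filter_upwards [hX.initial, hY.initial] with ω h1 h2
    have h0 : gridPt T M 0 = 0 := by simp [gridPt]
    simp [h0, h1, h2]
  · intro k hk
    filter_upwards [hX.step hWm hd hD hφ hf (hkM hk), hY.step k (hkM hk)] with ω h1 h2
    rw [← map_smul, ← map_add, ← map_add]
    congr 1
    rw [map_sub, smul_sub]
    refine (congrArg₂ (· - ·) h1.1 h2).trans ?_
    simp only [R, τ]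
    abel
  · exact fun k _ => Eventually.of_forall fun ω => norm_energyMap_groupN lam φ N τ _
  · intro k hk
    filter_upwards [hY.mem (hkM hk)] with ω h
    have hx := hX.mem_galerkinProd (gridPt_le T (hkM hk) hM) ω
    have hsub := Submodule.sub_mem _ hx h
    have h1 : driftN φ f N (X (gridPt T M (k + 1)) ω) - driftN φ f N (Y (k + 1) ω) =
        (0, projN φ N (nemytskij f (X (gridPt T M (k + 1)) ω).2) -
          projN φ N (nemytskij f (Y (k + 1) ω).2)) := by
      simp [driftN]
    have h2 : ‖(X (gridPt T M (k + 1)) ω - Y (k + 1) ω).2‖ ^ 2 ≤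
        ‖J (X (gridPt T M (k + 1)) ω - Y (k + 1) ω)‖ ^ 2 := by
      rw [energyMap_apply, WithLp.prod_norm_sq_eq_of_L2]
      conv_lhs => rw [← projN_of_mem φ hsub.2]
      exact le_add_of_nonneg_left (sq_nonneg _)
    rw [h1, inner_energyMap_snd, projN_of_mem φ hsub.2,
      projN_of_mem φ (Submodule.sub_mem _ (projN_mem φ N _) (projN_mem φ N _))]
    exact (inner_projN_nemytskij_sub_le_max hd hD hφ hf hx.2 h.2).trans
      (mul_le_mul_of_nonneg_left h2 (le_max_left _ _))
  · exact fun k hk => (J.comp (groupN lam φ N τ)).continuous.comp_aestronglyMeasurable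
      (hem (hkM hk).le)
  · exact fun k hk => J.continuous.comp_aestronglyMeasurable ((hem (hkM hk)).mono (ℱ.le _))
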